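/- Let $n\in\mathbb N$, $[n]=\{1,\dots,n\}$, and let $G^\star$ be a directed graph on $[n]$ (directed cycles allowed). **Graph notions.** In a directed graph $G=([n],E)$, $a$ is an *ancestor* of $b$ (and $b$ a *descendant* of $a$) if there is a directed path, possibly of length $0$, from $a$ to $b$. Distinct vertices $a,b$ are *p-adjacent* if there is an edge between them or they have a common child that is an ancestor of $a$ or of $b$. Vertices $a\ne b$ are *d-connected* given $Z\subseteq[n]\setminus\{a,b\}$ if there is a path from $a$ to $b$ (distinct vertices, edges of either direction) on which every collider has a descendant in $Z$ and no other inner vertex is in $Z$. For pairwise disjoint $A,B,Z$, $A\perp B\mid Z$ in $G$ (*d-separation*) if no $a\in A$, $b\in B$ are d-connected given $Z$. Two graphs on $[n]$ are *Markov equivalent* if they satisfy the same d-separation statements. Below, $\perp$ without mention of a graph is d-separation in $G^\star$ (equivalently, conditional independence in a distribution that is Markov and faithful to $G^\star$). **Partially ordered partitions.** Let $\mathcal S$ be the set of pairs $(\mathcal P,\pi)$ of a partition $\mathcal P$ of $[n]$ and a partial order $\leq_\pi$ on $\mathcal P$; $C_a$ is the section containing $a$, and $C\leq_\pi\max\{C_1,\dots,C_k\}$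 means $C\leq_\pi C_i$ for some $i$. For $S\subseteq[n]$ let $\downarrow S=\bigcup\{C\in\mathcal P: C\leq_\pi C_x\text{ for some }x\in S\}$. The partially ordered partition *associated with* $G$ consists of the strongly connected components of $G$, with $C_1\le C_2$ iff $C_1=C_2$ or there is a directed path from any vertex of $C_1$ to any vertex of $C_2$. For $(\mathcal P,\pi)\in\mathcal S$ define - $E^{(1)}=\{(a,b): a\neq b,\ a\not\perp b\mid {\downarrow}\{a,b\}\setminus\{a,b\}\}$; - $E^{(2)}$: the triples $(a,b,c)$ of distinct vertices with $(a,b),(c,b)\in E^{(1)}$, $(a,c)\notin E^{(1)}$, $C_b\leq_\pi\max\{C_a,C_c\}$; - $E^{(3)}$: the triples $(a,b,c)$ of distinct vertices with $(a,b),(c,b)\in E^{(1)}$, $(a,c)\notin E^{(1)}$, $a\not\perp c\mid{\downarrow}\{a,b,c\}\setminus\{a,c\}$; - $E^{(4)}$: the pairs $((a,b_1,c),(a,b_2,c))$, with $a,b_1,c$ distinct and $a,b_2,c$ distinct, such that $(a,b_i),(c,b_i)\in E^{(1)}$ and $(a,b_i,c)\notin E^{(2)}\cup E^{(3)}$ for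 $i=1,2$, $(a,c)\notin E^{(1)}$, and $C_{b_1}\leq_\pi C_{b_2}$; - $D^{(t)}$ ($t\geq1$): the tuples $(a_0,\dots,a_{t+1})$ of distinct vertices with $(a_i,a_{i+1})\in E^{(1)}$ for $0\le i\le t$, $(a_i,a_j)\notin E^{(1)}$ whenever $0\le j\leq i-2\le t-1$, $C_{a_1}=\dots=C_{a_t}$, and $C_{a_1}\not\leq_\pi\max\{C_{a_0},C_{a_{t+1}}\}$; - $E^{(6)}$: the pairs $((a_0,\dots,a_{t+1}),(a_0,b,a_{t+1}))$, $1\leq t\leq n-2$, with $a_0,b,a_{t+1}$ distinct, $(a_0,b),(a_{t+1},b)\in E^{(1)}$, $(a_0,b,a_{t+1})\notin E^{(2)}\cup E^{(3)}$, $(a_0,\dots,a_{t+1})\in D^{(t)}$, and $C_{a_1}\leq_\pi C_b$. Let $S_1=\arg\min_{\mathcal S}|E^{(1)}|$, $S_i=\arg\min_{S_{i-1}}|E^{(i)}|$ for $i=2,3,4$, $S_5^{(1)}=S_4$, $S_5^{(t)}=\arg\max_{S_5^{(t-1)}}|D^{(t)}|$ for $2\leq t\leq n-2$, and $S_6=\arg\min_{S_5^{(n-2)}}|E^{(6)}|$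 (with $S_5^{(n-2)}:=S_4$ if $n\leq 2$). **Theorem.** Let $(\mathcal P,\pi)\in S_6$, and let $G=([n],E)$ be a directed graph such that 1. for all $a,b$: $a$ and $b$ are p-adjacent in $G$ iff $(a,b)\in E^{(1)}$; 2. for all $a,b$: $a$ is an ancestor of $b$ in $G$ iff $C_a\leq_\pi C_b$; 3. if $(a,b,c)\in E^{(3)}$, and $(a,b',c)\notin E^{(3)}$ for all $b'$ with $C_{b'}\leq_\pi C_b$ and $C_{b'}\neq C_b$, then $a$ and $c$ have a common child in $C_b$ in $G$; 4. if $a\neq c$, $(a,b),(c,b)\in E^{(1)}$, $(a,c)\notin E^{(1)}$, $C_b\not\leq_\pi\max\{C_a,C_c\}$, and $(a,b,c)\notin E^{(3)}$, then $a$ and $c$ have no common child in $C_b$ in $G$. Then $G$ is Markov equivalent to $G^\star$. Moreover, $G=G^\star$ satisfies 1–4 with respect to the partially ordered partition associated with $G^\star$. -/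

import Mathlib

namespace CyclicCausal

/-! ### Directed graphs -/

section Graph

variable {V : Type*}

/-- `a` is an ancestor of `b` (and `b` a descendant of `a`): there is a directed path, possibly of
length zero, from `a` to `b`. -/
def IsAncestor (G : Digraph V) (a b : V) : Prop := Relation.ReflTransGen G.Adj a b

/-- `d` is a common child of `a` and `b`. -/
def IsCommonChild (G : Digraph V) (a b d : V) : Prop := G.Adj a d ∧ G.Adj b d

/-- Two (distinct) vertices are p-adjacent if there is an edge between them, or if they have a
common child which is an ancestor of one of them. -/
def PAdj (G : Digraph V) (a b : V) : Prop :=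
  a ≠ b ∧ ((G.Adj a b ∨ G.Adj b a) ∨
    ∃ d, IsCommonChild G a b d ∧ (IsAncestor G d a ∨ IsAncestor G d b))

/-- `a` and `b` are d-connected given `Z`: there is a path `v 0 = a, …, v m = b` of distinct
vertices, with a chosen edge `v i → v (i+1)` (if `fwd i` is true) or `v (i+1) → v i` (if `fwd i`
is false) between any two consecutive ones, such that every collider on the path has a
descendant in `Z` (possibly itself) and no other inner vertex lies in `Z`. -/
def DConnected (G : Digraph V) (a b : V) (Z : Set V) : Prop :=
  ∃ (m : ℕ) (v : ℕ → V) (fwd : ℕ → Bool),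
    v 0 = a ∧ v m = b ∧ Set.InjOn v (Set.Iic m) ∧
    (∀ i < m, (fwd i = true → G.Adj (v i) (v (i + 1))) ∧
      (fwd i = false → G.Adj (v (i + 1)) (v i))) ∧
    (∀ i, i + 1 < m →
      ((fwd i = true ∧ fwd (i + 1) = false) → ∃ z ∈ Z, IsAncestor G (v (i + 1)) z) ∧
      (¬ (fwd i = true ∧ fwd (i + 1) = false) → v (i + 1) ∉ Z))

/-- `A` and `B` are d-separated by `Z` in `G` (meant for pairwise disjoint `A`, `B`, `Z`). -/
def DSep (G : Digraph V) (A B Z : Set V) : Prop :=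
  ∀ a ∈ A, ∀ b ∈ B, ¬ DConnected G a b Z

/-- Two directed graphs on the same vertices are Markov equivalent if they satisfy the same
d-separation statements. -/
def MarkovEquivalent (G H : Digraph V) : Prop :=
  ∀ A B Z : Set V, Disjoint A B → Disjoint A Z → Disjoint B Z → (DSep G A B Z ↔ DSep H A B Z)

end Graph

/-! ### Partially ordered partitions -/

/-- A partition of the vertex set (into nonempty sections) with a partial order on the set of
its sections. -/
structure POPartition (n : ℕ) where
  /-- the partition -/
  partition : Finpartition (Finset.univ : Finset (Fin n))
  /-- the partial order on the sections -/
  le : partition.parts → partition.parts → Prop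
  le_refl : ∀ C, le C C
  le_trans : ∀ C₁ C₂ C₃, le C₁ C₂ → le C₂ C₃ → le C₁ C₃
  le_antisymm : ∀ C₁ C₂, le C₁ C₂ → le C₂ C₁ → C₁ = C₂

/-- The section containing the vertex `a`. -/
def POPartition.sec {n : ℕ} (P : POPartition n) (a : Fin n) : P.partition.parts :=
  ⟨P.partition.part a, P.partition.part_mem.2 (Finset.mem_univ a)⟩

/-- The relation `C_a ≤ max {C_b, C_c}`, i.e. `C_a ≤ C_b` or `C_a ≤ C_c`. -/
def POPartition.LeMax {n : ℕ} (P : POPartition n) (a b c : Fin n) : Prop :=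
  P.le (P.sec a) (P.sec b) ∨ P.le (P.sec a) (P.sec c)

/-- The equivalence relation whose classes are the strongly connected components of `G`. -/
def strongSetoid {n : ℕ} (G : Digraph (Fin n)) : Setoid (Fin n) where
  r i j := IsAncestor G i j ∧ IsAncestor G j i
  iseqv :=
    { refl := fun _ => ⟨Relation.ReflTransGen.refl, Relation.ReflTransGen.refl⟩
      symm := fun h => ⟨h.2, h.1⟩
      trans := fun h k => ⟨h.1.trans k.1, k.2.trans h.2⟩ }

open Classical in
/-- The partition of the vertices into the strongly connected components of `G`. -/
noncomputable def strongComponents {n : ℕ} (G : Digraph (Fin n)) :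
    Finpartition (Finset.univ : Finset (Fin n)) :=
  Finpartition.ofSetoid (strongSetoid G)

theorem mem_strongComponents_rel {n : ℕ} (G : Digraph (Fin n)) {C : Finset (Fin n)}
    (hC : C ∈ (strongComponents G).parts) {x y : Fin n} (hx : x ∈ C) :
    y ∈ C ↔ IsAncestor G x y ∧ IsAncestor G y x := by
  classical
  have h : C = (strongComponents G).part x := ((strongComponents G).part_eq_of_mem hC hx).symm
  subst h
  unfold strongComponents
  rw [Finpartition.mem_part_ofSetoid_iff_rel]
  rfl

/-- The partially ordered partition associated with `G`: the strongly connected components, with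
`C₁ ≤ C₂` if `C₁ = C₂` or there is a directed path from any vertex of `C₁` to any vertex
of `C₂`. -/
noncomputable def assocPOPartition {n : ℕ} (G : Digraph (Fin n)) : POPartition n where
  partition := strongComponents G
  le C₁ C₂ := C₁ = C₂ ∨ ∀ x ∈ C₁.1, ∀ y ∈ C₂.1, IsAncestor G x y
  le_refl _ := Or.inl rfl
  le_trans := by
    rintro C₁ C₂ C₃ (rfl | h) (rfl | k)
    · exact Or.inl rfl
    · exact Or.inr k
    · exact Or.inr h
    · obtain ⟨y, hy⟩ := (strongComponents G).nonempty_of_mem_parts C₂.2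
      exact Or.inr fun x hx z hz => (h x hx y hy).trans (k y hy z hz)
  le_antisymm := by
    rintro C₁ C₂ (rfl | h) (k | k)
    · rfl
    · rfl
    · exact k.symm
    · obtain ⟨x, hx⟩ := (strongComponents G).nonempty_of_mem_parts C₁.2
      obtain ⟨y, hy⟩ := (strongComponents G).nonempty_of_mem_parts C₂.2
      have hxC : x ∈ C₂.1 :=
        (mem_strongComponents_rel G C₂.2 hy).2 ⟨k y hy x hx, h x hx y hy⟩
      exact Subtype.ext ((strongComponents G).eq_of_mem_parts C₁.2 C₂.2 hx hxC)

/-! ### The sets entering the graphical score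

Throughout, `Gs` is the true graph. Conditional independence of the observed variables is
d-separation in `Gs`. -/

section Score

variable {n : ℕ} (Gs : Digraph (Fin n)) (P : POPartition n)

/-- The union of all sections `C` with `C ≤ C_x` for some `x` in the set `S`. -/
def POPartition.down {n : ℕ} (P : POPartition n) (S : Set (Fin n)) : Set (Fin n) :=
  {v | ∃ C : P.partition.parts, (∃ x ∈ S, P.le C (P.sec x)) ∧ v ∈ C.1}

/-- `E⁽¹⁾`. -/
def E1 : Set (Fin n × Fin n) :=
  {p | p.1 ≠ p.2 ∧ ¬ DSep Gs {p.1} {p.2} (P.down {p.1, p.2} \ {p.1, p.2})}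

/-- `E⁽²⁾`. -/
def E2 : Set (Fin n × Fin n × Fin n) :=
  {(a, b, c) | (a ≠ b ∧ b ≠ c ∧ a ≠ c) ∧ (a, b) ∈ E1 Gs P ∧ (c, b) ∈ E1 Gs P ∧
    (a, c) ∉ E1 Gs P ∧ P.LeMax b a c}

/-- `E⁽³⁾`. -/
def E3 : Set (Fin n × Fin n × Fin n) :=
  {(a, b, c) | (a ≠ b ∧ b ≠ c ∧ a ≠ c) ∧ (a, b) ∈ E1 Gs P ∧ (c, b) ∈ E1 Gs P ∧
    (a, c) ∉ E1 Gs P ∧ ¬ DSep Gs {a} {c} (P.down {a, b, c} \ {a, c})}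

/-- `E⁽⁴⁾`. -/
def E4 : Set ((Fin n × Fin n × Fin n) × (Fin n × Fin n × Fin n)) :=
  {q | ∃ a b₁ b₂ c, q = ((a, b₁, c), (a, b₂, c)) ∧
    (a ≠ b₁ ∧ b₁ ≠ c ∧ a ≠ c) ∧ (a ≠ b₂ ∧ b₂ ≠ c ∧ a ≠ c) ∧
    (a, b₁) ∈ E1 Gs P ∧ (c, b₁) ∈ E1 Gs P ∧ (a, b₂) ∈ E1 Gs P ∧ (c, b₂) ∈ E1 Gs P ∧
    (a, c) ∉ E1 Gs P ∧
    (a, b₁, c) ∉ E2 Gs P ∧ (a, b₂, c) ∉ E2 Gs P ∧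
    (a, b₁, c) ∉ E3 Gs P ∧ (a, b₂, c) ∉ E3 Gs P ∧
    P.le (P.sec b₁) (P.sec b₂)}

/-- `D⁽ᵗ⁾`, a set of tuples `(a 0, a 1, …, a (t+1))` (used for `t ≥ 1`). -/
def D (t : ℕ) : Set (Fin (t + 2) → Fin n) :=
  {a | Function.Injective a ∧
    (∀ i : Fin (t + 1), (a i.castSucc, a i.succ) ∈ E1 Gs P) ∧
    (∀ i j : Fin (t + 2), (j : ℕ) + 2 ≤ (i : ℕ) → (a i, a j) ∉ E1 Gs P) ∧
    (∀ i : Fin (t + 2), 1 ≤ (i : ℕ) → (i : ℕ) ≤ t → P.sec (a i) = P.sec (a 1)) ∧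
    ¬ P.LeMax (a 1) (a 0) (a (Fin.last (t + 1)))}

/-- `E⁽⁶⁾`; an element is a triple of `t`, a tuple `(a 0, …, a (t+1))` and `(a 0, b, a (t+1))`,
where `1 ≤ t ≤ n - 2`. -/
def E6 : Set (Σ t : ℕ, (Fin (t + 2) → Fin n) × (Fin n × Fin n × Fin n)) :=
  {q | ∃ (t : ℕ) (a : Fin (t + 2) → Fin n) (b : Fin n),
    q = ⟨t, a, (a 0, b, a (Fin.last (t + 1)))⟩ ∧ 1 ≤ t ∧ t + 2 ≤ n ∧
    (a 0 ≠ b ∧ b ≠ a (Fin.last (t + 1)) ∧ a 0 ≠ a (Fin.last (t + 1))) ∧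
    (a 0, b) ∈ E1 Gs P ∧ (a (Fin.last (t + 1)), b) ∈ E1 Gs P ∧
    (a 0, b, a (Fin.last (t + 1))) ∉ E2 Gs P ∧
    (a 0, b, a (Fin.last (t + 1))) ∉ E3 Gs P ∧
    a ∈ D Gs P t ∧
    P.le (P.sec (a 1)) (P.sec b)}

/-- `E⁽⁶⁾` is finite, so that `Set.ncard` is its number of elements. -/
theorem E6_finite : (E6 Gs P).Finite := by
  have h : (E6 Gs P) ⊆ ⋃ t ∈ Set.Iic n, Set.range
      (fun x : (Fin (t + 2) → Fin n) × (Fin n × Fin n × Fin n) =>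
        (⟨t, x⟩ : Σ t : ℕ, (Fin (t + 2) → Fin n) × (Fin n × Fin n × Fin n))) := by
    rintro q ⟨t, a, b, rfl, -, ht, -⟩
    simp only [Set.mem_iUnion]
    exact ⟨t, by simp only [Set.mem_Iic]; omega, ⟨_, rfl⟩⟩
  exact ((Set.finite_Iic n).biUnion fun t _ => Set.finite_range _).subset h

end Score

/-! ### Successive optimization -/

/-- The minimizers of `f` over `S`. -/
def argmin {α : Type*} (S : Set α) (f : α → ℕ) : Set α := {x ∈ S | ∀ y ∈ S, f x ≤ f y}

/-- The maximizers of `f` over `S`. -/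
def argmax {α : Type*} (S : Set α) (f : α → ℕ) : Set α := {x ∈ S | ∀ y ∈ S, f y ≤ f x}

section Optimal

variable {n : ℕ} (Gs : Digraph (Fin n))

noncomputable def S1 : Set (POPartition n) := argmin Set.univ fun P => (E1 Gs P).ncard

noncomputable def S2 : Set (POPartition n) := argmin (S1 Gs) fun P => (E2 Gs P).ncard

noncomputable def S3 : Set (POPartition n) := argmin (S2 Gs) fun P => (E3 Gs P).ncard

noncomputable def S4 : Set (POPartition n) := argmin (S3 Gs) fun P => (E4 Gs P).ncard

/-- `S₅⁽ᵗ⁾`: it is `S₄` for `t = 1` (and, by convention, for `t = 0`), and the set of maximizers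
of `|D⁽ᵗ⁾|` over `S₅⁽ᵗ⁻¹⁾` for `t ≥ 2`. -/
noncomputable def S5 : ℕ → Set (POPartition n)
  | 0 => S4 Gs
  | 1 => S4 Gs
  | t + 2 => argmax (S5 (t + 1)) fun P => (D Gs P (t + 2)).ncard

/-- The optimal partially ordered partitions: the minimizers of `|E⁽⁶⁾|` over `S₅⁽ⁿ⁻²⁾`. -/
noncomputable def S6 : Set (POPartition n) := argmin (S5 Gs (n - 2)) fun P => (E6 Gs P).ncard

end Optimal

/-! ### The four properties -/

/-- The directed graph `G` has the four properties with respect to the partially ordered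
partition `P`, where `Gs` is the true graph. -/
structure HasProperties {n : ℕ} (Gs : Digraph (Fin n)) (P : POPartition n)
    (G : Digraph (Fin n)) : Prop where
  pAdj_iff : ∀ a b, PAdj G a b ↔ (a, b) ∈ E1 Gs P
  ancestor_iff : ∀ a b, IsAncestor G a b ↔ P.le (P.sec a) (P.sec b)
  commonChild : ∀ a b c, (a, b, c) ∈ E3 Gs P →
    (∀ b', P.le (P.sec b') (P.sec b) → P.sec b' ≠ P.sec b → (a, b', c) ∉ E3 Gs P) →
    ∃ d, d ∈ (P.sec b).1 ∧ IsCommonChild G a c d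
  noCommonChild : ∀ a b c, a ≠ c → (a, b) ∈ E1 Gs P → (c, b) ∈ E1 Gs P → (a, c) ∉ E1 Gs P →
    ¬ P.LeMax b a c → (a, b, c) ∉ E3 Gs P →
    ¬ ∃ d, d ∈ (P.sec b).1 ∧ IsCommonChild G a c d

end CyclicCausal

/-!
By Richardson's cyclic equivalence theorem, d-separation is determined by the p-adjacencies, by the
unshielded triples `(a, b, c)` such that `b` is a descendant of a common child of `a` and `c`, by
the mutual chains (the induced paths `a₀, …, aₜ₊₁` whose inner vertices are ancestors of each other,
but not of the endpoints), and by the ancestral relation between a mutual chain and the unshielded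
triples with the same endpoints. Indeed, `a` and `b` are d-connected given `Z` if and only if they
are connected outside `Z` in the moral graph of the subgraph of the ancestors of `{a, b} ∪ Z`. If a
shortest such connection in `G` left the ancestors in `H`, then a maximal segment outside of them
would be a mutual chain in `H`, hence in `G`, and its descent to `{a, b} ∪ Z` in `G` could be
transferred to `H`.

Whatever the partition, the true dependences are visible in the score: the sets `E⁽ⁱ⁾` of the
partition associated with the true graph are contained in those of any partition that agrees with it
at the earlier stages, with the reverse inclusion for `D⁽ᵗ⁾`. The optimal partitions at each stage
are therefore those that give the same sets as the true graph, and the four properties turn these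
sets into the invariants of `G`.
-/

namespace CyclicCausal

open Relation

/-! ### Induced paths -/

section InducedPath

variable {V : Type*}

theorem exists_last_le {p : ℕ → Prop} {i m : ℕ} (him : i ≤ m) (hi : p i) :
    ∃ j ≤ m, p j ∧ ∀ k ≤ m, j < k → ¬ p k := by
  classical
  exact ⟨Nat.findGreatest p m, Nat.findGreatest_le m, Nat.findGreatest_spec him hi,
    fun k hkm hk => Nat.findGreatest_is_greatest hk hkm⟩

theorem rel_of_forall_rel_succ {α : Type*} {r : α → α → Prop} [IsPreorder α r] {v : ℕ → α}
    {i j : ℕ} (hij : i ≤ j) (h : ∀ k, i ≤ k → k < j → r (v k) (v (k + 1))) : r (v i) (v j) := by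
  induction j, hij using Nat.le_induction with
  | base => exact refl _
  | succ j hij ih => exact _root_.trans (ih fun k hk hkj => h k hk (by omega)) (h j hij (by omega))

/-- The sequence `a, v 0, v 1, …`. -/
def consSeq (a : V) (v : ℕ → V) : ℕ → V
  | 0 => a
  | i + 1 => v i

/-- `v 0, …, v m` is a chordless path of distinct vertices for the relation `r`. -/
structure IsInducedPath (r : V → V → Prop) (m : ℕ) (v : ℕ → V) : Prop where
  step : ∀ i < m, r (v i) (v (i + 1))
  not_step : ∀ i j, i + 2 ≤ j → j ≤ m → ¬ r (v i) (v j)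
  ne : ∀ i j, i < j → j ≤ m → v i ≠ v j

namespace IsInducedPath

variable {r : V → V → Prop} {m : ℕ} {v : ℕ → V}

theorem injective (h : IsInducedPath r m v) :
    Function.Injective fun i : Fin (m + 1) => v i := by
  intro i j hij
  by_contra hne
  rcases Nat.lt_or_gt_of_ne (Fin.val_ne_of_ne hne) with hlt | hlt
  · exact h.ne i j hlt (by omega) hij
  · exact h.ne j i hlt (by omega) hij.symm

theorem segment (h : IsInducedPath r m v) {k l : ℕ} (hkl : k + l ≤ m) :
    IsInducedPath r l fun i => v (k + i) where
  step i hi := h.step (k + i) (by omega)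
  not_step i j hij hj := h.not_step _ _ (by omega) (by omega)
  ne i j hij hj := h.ne _ _ (by omega) (by omega)

theorem cons (h : IsInducedPath r m v) {a : V} (ha : r a (v 0))
    (hchord : ∀ i ≤ m, 0 < i → ¬ r a (v i)) (hne : ∀ i ≤ m, a ≠ v i) :
    IsInducedPath r (m + 1) (consSeq a v) where
  step
    | 0, _ => ha
    | i + 1, hi => h.step i (by omega)
  not_step
    | 0, j + 1, hij, hj => hchord j (by omega) (by omega)
    | i + 1, j + 1, hij, hj => h.not_step i j (by omega) (by omega)
  ne
    | 0, j + 1, _, hj => hne j (by omega)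
    | i + 1, j + 1, hij, hj => h.ne i j (by omega) (by omega)

end IsInducedPath

theorem exists_isInducedPath {r : V → V → Prop} {T : Set V} {a t : V} (ht : t ∈ T)
    (hat : ReflTransGen r a t) :
    ∃ m v, v 0 = a ∧ v m ∈ T ∧ (∀ i < m, v i ∉ T) ∧ IsInducedPath r m v := by
  induction hat using ReflTransGen.head_induction_on with
  | refl => exact ⟨0, fun _ => t, rfl, ht, by simp, by constructor <;> intros <;> omega⟩
  | @head a c hac _ ih =>
    by_cases haT : a ∈ T
    · exact ⟨0, fun _ => a, rfl, haT, by simp, by constructor <;> intros <;> omega⟩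
    obtain ⟨m, v, rfl, hmT, hT, hv⟩ := ih
    -- Jump from `a` to the last vertex of the path that can be reached in at most one step.
    obtain ⟨j, hjm, hj, hlast⟩ :=
      exists_last_le (p := fun i => a = v i ∨ r a (v i)) m.zero_le (Or.inr hac)
    have hseg := hv.segment (k := j) (l := m - j) (by omega)
    have hend : j + (m - j) = m := by omega
    by_cases haj : a = v j
    · exact ⟨m - j, fun i => v (j + i), haj.symm, by simpa only [hend],
        fun i hi => hT _ (by omega), hseg⟩
    · refine ⟨m - j + 1, consSeq a fun i => v (j + i), rfl, by simpa only [consSeq, hend], ?_,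
        hseg.cons (hj.resolve_left haj)
          (fun i hi h0 h => hlast (j + i) (by omega) (by omega) (Or.inr h)) fun i hi h => ?_⟩
      · rintro (_ | i) hi
        · exact haT
        · exact hT (j + i) (by omega)
      · rcases i.eq_zero_or_pos with rfl | h0
        · exact haj h
        · exact hlast (j + i) (by omega) (by omega) (Or.inl h)

end InducedPath

/-! ### Mutual chains -/

section MutualChain

/-- Take the interval around a maximal term outside `U` on which the sequence stays above this
term. -/
theorem exists_maximal_interval {α : Type*} [Preorder α] {U : Set α} (hU : IsLowerSet U)
    {x : ℕ → α} {m i : ℕ} (h0 : x 0 ∈ U) (hm : x m ∈ U) (him : i ≤ m) (hi : x i ∉ U) :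
    ∃ k t, 1 ≤ t ∧ k + t + 1 ≤ m ∧ (∀ e, 1 ≤ e → e ≤ t → x (k + e) ∉ U) ∧
      (∀ e, 1 ≤ e → e ≤ t → x (k + e) ≤ x (k + 1) ∧ x (k + 1) ≤ x (k + e)) ∧
      ¬ x (k + 1) ≤ x k ∧ ¬ x (k + 1) ≤ x (k + t + 1) := by
  classical
  obtain ⟨j, hj, hmax⟩ := Finset.exists_maximalFor x {j ∈ Finset.range (m + 1) | x j ∉ U}
    ⟨i, by simp only [Finset.mem_filter, Finset.mem_range]; exact ⟨by omega, hi⟩⟩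
  simp only [Finset.mem_filter, Finset.mem_range] at hj hmax
  have hout : ∀ {e}, x j ≤ x e → x e ∉ U := fun hle h => hj.2 (hU hle h)
  have hj0 : j ≠ 0 := by rintro rfl; exact hj.2 h0
  have hjm : j ≠ m := by rintro rfl; exact hj.2 hm
  obtain ⟨k, hkj, hk, hleft⟩ := exists_last_le (p := fun e => ¬ x j ≤ x e) (Nat.zero_le (j - 1))
    fun h => hout h h0
  have hright : ∃ e, j < e ∧ ¬ x j ≤ x e := ⟨m, by omega, fun h => hout h hm⟩
  obtain ⟨hjl, hl⟩ := Nat.find_spec hright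
  have hlm : Nat.find hright ≤ m := Nat.find_min' hright ⟨by omega, fun h => hout h hm⟩
  have hmin : ∀ e < Nat.find hright, j < e → x j ≤ x e := fun e he hje =>
    not_not.1 fun h => Nat.find_min hright he ⟨hje, h⟩
  generalize Nat.find hright = l at hjl hl hlm hmin
  have hin : ∀ e, k < e → e < l → x j ≤ x e ∧ x e ≤ x j := by
    intro e hke hel
    have hle : x j ≤ x e := by
      rcases lt_trichotomy e j with h | rfl | h
      · exact not_not.1 (hleft e (by omega) hke)
      · exact le_rfl
      · exact hmin e hel h
    exact ⟨hle, hmax ⟨by omega, hout hle⟩ hle⟩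
  obtain ⟨hjk, hkj'⟩ := hin (k + 1) (by omega) (by omega)
  refine ⟨k, l - k - 1, by omega, by omega, fun e h1 h2 => ?_, fun e h1 h2 => ?_,
    fun h => hk (hjk.trans h), fun h => hl ?_⟩
  · exact hout (hin (k + e) (by omega) (by omega)).1
  · obtain ⟨h3, h4⟩ := hin (k + e) (by omega) (by omega)
    exact ⟨h4.trans hjk, hkj'.trans h3⟩
  · rw [show k + (l - k - 1) + 1 = l by omega] at h
    exact hjk.trans h

variable {V : Type*}

/-- An induced path `x 0, …, x (t + 1)` for `adj` whose inner vertices are equivalent for the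
preorder `le` and precede neither end. In a directed graph, with p-adjacency and ancestry, these
are the uncovered itineraries whose end segments are mutually exclusive conductors in Richardson's
characterization of Markov equivalence. -/
structure IsMutualChain (adj le : V → V → Prop) (t : ℕ) (x : ℕ → V) : Prop
    extends IsInducedPath adj (t + 1) x where
  equiv : ∀ i, 1 ≤ i → i ≤ t → le (x i) (x 1) ∧ le (x 1) (x i)
  not_le_left : ¬ le (x 1) (x 0)
  not_le_right : ¬ le (x 1) (x (t + 1))

namespace IsMutualChain

variable {adj le : V → V → Prop} {t : ℕ} {x : ℕ → V}

theorem pos [Std.Refl le] (h : IsMutualChain adj le t x) : 1 ≤ t := by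
  by_contra ht
  obtain rfl : t = 0 := by omega
  exact h.not_le_right (refl _)

theorem le_of_inner [IsTrans V le] (h : IsMutualChain adj le t x) {i j : ℕ} (hi1 : 1 ≤ i)
    (hit : i ≤ t) (hj1 : 1 ≤ j) (hjt : j ≤ t) : le (x i) (x j) :=
  _root_.trans (h.equiv i hi1 hit).1 (h.equiv j hj1 hjt).2

theorem not_adj_ends [Std.Refl le] (h : IsMutualChain adj le t x) : ¬ adj (x 0) (x (t + 1)) :=
  h.not_step _ _ (by have := h.pos; omega) le_rfl

theorem ne_ends (h : IsMutualChain adj le t x) : x 0 ≠ x (t + 1) :=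
  h.ne _ _ t.succ_pos le_rfl

theorem add_two_le_card [Fintype V] (h : IsMutualChain adj le t x) : t + 2 ≤ Fintype.card V := by
  simpa only [Fintype.card_fin] using Fintype.card_le_of_injective _ h.injective

theorem eq_of_segment [IsPreorder V le] (h : IsMutualChain adj le t x) {k s : ℕ}
    (hks : k + s ≤ t) (hs : IsMutualChain adj le s fun e => x (k + e)) : k = 0 ∧ s = t := by
  have hpos := hs.pos
  have hk : k = 0 := by
    by_contra hk
    exact hs.not_le_left (h.le_of_inner (by omega) (by omega) (by omega) (by omega))
  refine ⟨hk, ?_⟩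
  by_contra hst
  exact hs.not_le_right (h.le_of_inner (by omega) (by omega) (by omega) (by omega))

end IsMutualChain

theorem exists_isMutualChain {adj le : V → V → Prop} [IsPreorder V le] {U : Set V}
    (hU : ∀ ⦃x y⦄, le x y → y ∈ U → x ∈ U) {x : ℕ → V} {m i : ℕ} (h0 : x 0 ∈ U) (hm : x m ∈ U)
    (him : i ≤ m) (hi : x i ∉ U)
    (hadj : ∀ i < m, x i ∉ U ∨ x (i + 1) ∉ U → adj (x i) (x (i + 1)))
    (hchord : ∀ i j, i + 2 ≤ j → j ≤ m → ¬ adj (x i) (x j))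
    (hne : ∀ i j, i < j → j ≤ m → x i ≠ x j) :
    ∃ k t, k + t + 1 ≤ m ∧ (∀ e, 1 ≤ e → e ≤ t → x (k + e) ∉ U) ∧
      IsMutualChain adj le t fun e => x (k + e) := by
  let : Preorder V := { le := le, le_refl := refl_of le, le_trans := fun _ _ _ => trans_of le }
  obtain ⟨k, t, ht, hkt, hout, heq, hl, hr⟩ :=
    exists_maximal_interval (fun _ _ hle hy => hU hle hy) h0 hm him hi
  refine ⟨k, t, hkt, hout, ⟨fun e he => hadj (k + e) (by omega) ?_,
    fun i j hij hj => hchord _ _ (by omega) (by omega),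
    fun i j hij hj => hne _ _ (by omega) (by omega)⟩, heq, hl, hr⟩
  rcases e.eq_zero_or_pos with rfl | he0
  · exact Or.inr (hout 1 le_rfl ht)
  · exact Or.inl (hout e he0 (by omega))

end MutualChain

/-! ### The moral graph criterion -/

section Moral

variable {V : Type*} {G : Digraph V} {a b c x y : V} {S W Z : Set V}

instance (G : Digraph V) : IsPreorder V (IsAncestor G) :=
  inferInstanceAs (IsPreorder V (ReflTransGen G.Adj))

theorem PAdj.symm (h : PAdj G a b) : PAdj G b a := by
  obtain ⟨hne, hadj | ⟨d, hd, hanc⟩⟩ := h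
  · exact ⟨hne.symm, Or.inl hadj.symm⟩
  · exact ⟨hne.symm, Or.inr ⟨d, hd.symm, hanc.symm⟩⟩

theorem PAdj.of_adj (hne : a ≠ b) (h : G.Adj a b) : PAdj G a b := ⟨hne, Or.inl (Or.inl h)⟩

/-- The ancestors of the vertices in `S`. -/
def ancestralSet (G : Digraph V) (S : Set V) : Set V := {v | ∃ s ∈ S, IsAncestor G v s}

theorem subset_ancestralSet : S ⊆ ancestralSet G S := fun s hs => ⟨s, hs, .refl⟩

theorem ancestralSet_mono {T : Set V} (h : S ⊆ T) : ancestralSet G S ⊆ ancestralSet G T :=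
  fun _ ⟨s, hs, hv⟩ => ⟨s, h hs, hv⟩

theorem mem_ancestralSet_of_isAncestor (h : IsAncestor G x y) (hy : y ∈ ancestralSet G S) :
    x ∈ ancestralSet G S :=
  let ⟨s, hs, hys⟩ := hy
  ⟨s, hs, h.trans hys⟩

/-- Adjacency of distinct vertices in the moral graph of the subgraph induced by an ancestrally
closed set `W`. Vertices with a common child that is an ancestor of one of them count as
p-adjacent, so that only p-adjacency and the common children in `W` matter. -/
def MoralAdj (G : Digraph V) (W : Set V) (x y : V) : Prop :=
  PAdj G x y ∨ ∃ d ∈ W, IsCommonChild G x y d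

/-- Adjacency outside `Z` in the moral graph of the subgraph induced by `W`. -/
def MoralStep (G : Digraph V) (W Z : Set V) (x y : V) : Prop :=
  x ∈ W \ Z ∧ y ∈ W \ Z ∧ MoralAdj G W x y

/-- `a` and `b` are connected outside `Z` in the moral graph of the subgraph of the ancestors of
`a`, `b` and `Z`. -/
def MoralConn (G : Digraph V) (a b : V) (Z : Set V) : Prop :=
  ReflTransGen (MoralStep G (ancestralSet G ({a, b} ∪ Z)) Z) a b

/-- One step of a walk that satisfies the conditions of d-connection at its inner vertices. A state
consists of the current vertex and a flag telling whether the last edge points to it; the initial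
state has flag `false`. -/
inductive OpenStep (G : Digraph V) (Z : Set V) : V × Bool → V × Bool → Prop
  | out {x y : V} {f : Bool} : x ∉ Z → G.Adj x y → OpenStep G Z (x, f) (y, true)
  | back {x y : V} : x ∉ Z → G.Adj y x → OpenStep G Z (x, false) (y, false)
  | collider {x y : V} : x ∈ ancestralSet G Z → G.Adj y x → OpenStep G Z (x, true) (y, false)

theorem openStep_iff {f g : Bool} : OpenStep G Z (x, f) (y, g) ↔
    ((g = true → G.Adj x y) ∧ (g = false → G.Adj y x)) ∧
      ((f = true ∧ g = false) → x ∈ ancestralSet G Z) ∧ (¬ (f = true ∧ g = false) → x ∉ Z) := by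
  constructor
  · rintro (⟨hx, hadj⟩ | ⟨hx, hadj⟩ | ⟨hx, hadj⟩) <;> simp [hx, hadj]
  · rintro ⟨⟨hout, hin⟩, hcol, hncol⟩
    cases g with
    | true => exact .out (hncol (by simp)) (hout rfl)
    | false =>
      cases f with
      | true => exact .collider (hcol ⟨rfl, rfl⟩) (hin rfl)
      | false => exact .back (hncol (by simp)) (hin rfl)

namespace OpenStep

theorem isAncestor_or_mem_ancestralSet {g : Bool}
    (h : ReflTransGen (OpenStep G Z) (x, true) (y, g)) :
    (g = true ∧ IsAncestor G x y) ∨ x ∈ ancestralSet G Z := by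
  generalize hp : (x, true) = p at h
  induction h using ReflTransGen.head_induction_on generalizing x with
  | refl => cases hp; exact Or.inl ⟨rfl, .refl⟩
  | head hstep _ ih =>
    subst hp
    cases hstep with
    | out _ hadj =>
      exact (ih rfl).imp (fun h => ⟨h.1, .head hadj h.2⟩)
        (mem_ancestralSet_of_isAncestor (.single hadj))
    | collider hx _ => exact Or.inr hx

theorem mem_ancestralSet_of_false (h : ReflTransGen (OpenStep G Z) (a, false) (y, false)) :
    y ∈ ancestralSet G ({a} ∪ Z) := by
  generalize hq : (y, false) = q at h
  induction h generalizing y with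
  | refl => cases hq; exact subset_ancestralSet (Or.inl rfl)
  | tail _ hstep ih =>
    subst hq
    cases hstep with
    | back _ hadj => exact mem_ancestralSet_of_isAncestor (.single hadj) (ih rfl)
    | collider hx hadj =>
      exact mem_ancestralSet_of_isAncestor (.single hadj)
        (ancestralSet_mono Set.subset_union_right hx)

theorem mem_ancestralSet {f g : Bool} (hax : ReflTransGen (OpenStep G Z) (a, false) (x, f))
    (hxb : ReflTransGen (OpenStep G Z) (x, f) (b, g)) : x ∈ ancestralSet G ({a, b} ∪ Z) := by
  cases f with
  | false =>
    exact ancestralSet_mono (Set.union_subset_union_left Z (by simp))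
      (mem_ancestralSet_of_false hax)
  | true =>
    rcases isAncestor_or_mem_ancestralSet hxb with ⟨-, h⟩ | h
    · exact ⟨b, by simp, h⟩
    · exact ancestralSet_mono Set.subset_union_right h

/-- If cutting out the closed subwalk creates a collider, the subwalk starts forwards and ends
backwards, so that its first collider is a descendant of `x`. -/
theorem splice {f g h : Bool} (hloop : ReflTransGen (OpenStep G Z) (x, f) (x, g))
    (hstep : OpenStep G Z (x, g) (y, h)) : OpenStep G Z (x, f) (y, h) := by
  cases hstep with
  | out hx hadj => exact .out hx hadj
  | back hx hadj =>
    cases f with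
    | false => exact .back hx hadj
    | true =>
      exact .collider ((isAncestor_or_mem_ancestralSet hloop).resolve_left (by simp)) hadj
  | collider hx hadj =>
    cases f with
    | true => exact .collider hx hadj
    | false =>
      obtain heq | ⟨_, hfirst, _⟩ := hloop.cases_head
      · simp at heq
      · cases hfirst with
        | out hxZ _ | back hxZ _ => exact .back hxZ hadj

end OpenStep

theorem dConnected_of_openStep {f : Bool}
    (h : ReflTransGen (OpenStep G Z) (a, false) (b, f)) : DConnected G a b Z := by
  obtain ⟨m, s, hs0, hsm, hsT, hs⟩ := exists_isInducedPath (T := {s | s.1 = b}) rfl h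
  have hne : ∀ i j, i < j → j ≤ m → (s i).1 ≠ (s j).1 := by
    intro i j hij hj he
    rcases hj.lt_or_eq with hj | rfl
    · have hloop : ReflTransGen (OpenStep G Z) ((s i).1, (s i).2) ((s i).1, (s j).2) :=
        show ReflTransGen _ (s i) _ from
          he ▸ rel_of_forall_rel_succ hij.le fun k _ hk =>
            ReflTransGen.single (hs.step k (by omega))
      exact hs.not_step i (j + 1) (by omega) (by omega) (.splice hloop (he ▸ hs.step j hj))
    · exact hsT i hij (he.trans hsm)
  refine ⟨m, fun i => (s i).1, fun i => (s (i + 1)).2, by simp only [hs0], hsm, ?_,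
    fun i hi => (openStep_iff.1 (hs.step i hi)).1,
    fun i hi => (openStep_iff.1 (hs.step (i + 1) hi)).2⟩
  intro i hi j hj he
  by_contra hij
  rcases Nat.lt_or_gt_of_ne hij with hij | hij
  · exact hne i j hij hj he
  · exact hne j i hij hi he.symm

theorem DConnected.exists_openStep (h : DConnected G a b Z) (ha : a ∉ Z) :
    ∃ f, ReflTransGen (OpenStep G Z) (a, false) (b, f) := by
  obtain ⟨m, v, fwd, rfl, rfl, -, hadj, hinner⟩ := h
  let s : ℕ → V × Bool := fun i => (v i, consSeq false fwd i)
  refine ⟨_, rel_of_forall_rel_succ (r := ReflTransGen _) (v := s) m.zero_le fun i _ hi =>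
    .single (openStep_iff.2 ⟨hadj i hi, ?_⟩)⟩
  cases i with
  | zero => exact ⟨fun h => Bool.noConfusion h.1, fun _ => ha⟩
  | succ i => exact hinner i hi

theorem reflTransGen_moralStep_of_adj (hax : ReflTransGen (MoralStep G W Z) a x)
    (hx : x ∈ W \ Z) (hy : y ∈ W \ Z) (hxy : G.Adj x y ∨ G.Adj y x) :
    ReflTransGen (MoralStep G W Z) a y := by
  by_cases hne : x = y
  · exact hne ▸ hax
  · exact hax.tail ⟨hx, hy, Or.inl ⟨hne, Or.inl hxy⟩⟩

theorem moralConn_of_openStep {f : Bool} (hb : b ∉ Z)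
    (h : ReflTransGen (OpenStep G Z) (a, false) (b, f)) : MoralConn G a b Z := by
  set W := ancestralSet G ({a, b} ∪ Z)
  -- Colliders in `Z` are bypassed by an edge of the moral graph.
  have hinv : ∀ s, ReflTransGen (OpenStep G Z) (a, false) s →
      ReflTransGen (OpenStep G Z) s (b, f) →
      (s.1 ∉ Z → ReflTransGen (MoralStep G W Z) a s.1) ∧
      (s.2 = true → s.1 ∈ Z →
        ∃ u ∈ W \ Z, ReflTransGen (MoralStep G W Z) a u ∧ G.Adj u s.1) := by
    intro s hs
    induction hs with
    | refl => exact fun _ => ⟨fun _ => .refl, Bool.noConfusion⟩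
    | tail hs hstep ih =>
      intro hsb
      have hxW := OpenStep.mem_ancestralSet hs (.head hstep hsb)
      have hyW := OpenStep.mem_ancestralSet (hs.tail hstep) hsb
      obtain ⟨hreach, hcollider⟩ := ih (.head hstep hsb)
      cases hstep with
      | @out x y _ hx hadj =>
        exact ⟨fun hy => reflTransGen_moralStep_of_adj (hreach hx) ⟨hxW, hx⟩ ⟨hyW, hy⟩
          (Or.inl hadj),
          fun _ _ => ⟨x, ⟨hxW, hx⟩, hreach hx, hadj⟩⟩
      | @back x y hx hadj =>
        exact ⟨fun hy => reflTransGen_moralStep_of_adj (hreach hx) ⟨hxW, hx⟩ ⟨hyW, hy⟩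
          (Or.inr hadj),
          Bool.noConfusion⟩
      | @collider x y _ hadj =>
        refine ⟨fun hy => ?_, Bool.noConfusion⟩
        by_cases hx : x ∈ Z
        · obtain ⟨u, hu, hau, hux⟩ := hcollider rfl hx
          exact hau.tail ⟨hu, ⟨hyW, hy⟩, Or.inr ⟨x, hxW, hux, hadj⟩⟩
        · exact reflTransGen_moralStep_of_adj (hreach hx) ⟨hxW, hx⟩ ⟨hyW, hy⟩ (Or.inr hadj)
  exact (hinv _ h .refl).1 hb

/-- The vertices at which an open walk from `a` can arrive, with a flag as in `OpenStep`. -/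
def OpenReach (G : Digraph V) (a : V) (Z : Set V) (x : V) (f : Bool) : Prop :=
  ReflTransGen (OpenStep G Z) (a, false) (x, f)

namespace OpenReach

theorem of_isAncestor_start (hxa : IsAncestor G x a) (hx : x ∉ ancestralSet G Z) :
    OpenReach G a Z x false := by
  induction hxa using ReflTransGen.head_induction_on with
  | refl => exact .refl
  | @head x y hxy _ ih =>
    have hy : y ∉ ancestralSet G Z := fun hy => hx (mem_ancestralSet_of_isAncestor (.single hxy) hy)
    exact (ih hy).tail (.back (fun h => hy (subset_ancestralSet h)) hxy)

theorem of_isAncestor {f : Bool} (h : OpenReach G a Z x f) (hxy : IsAncestor G x y)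
    (hx : x ∉ ancestralSet G Z) : ∃ g, OpenReach G a Z y g := by
  induction hxy using ReflTransGen.head_induction_on generalizing f with
  | refl => exact ⟨f, h⟩
  | @head x w hxw _ ih =>
    exact ih (h.tail (.out (fun hxZ => hx (subset_ancestralSet hxZ)) hxw))
      fun hw => hx (mem_ancestralSet_of_isAncestor (.single hxw) hw)

/-- A collider that is not an ancestor of `Z` is an ancestor of `b`, which it then reaches, or of
`a`, from where it is also reached against the edges. -/
theorem against {f : Bool} (h : OpenReach G a Z x f) (hf : f = false → x ∉ Z)
    (hx : x ∈ ancestralSet G ({a, b} ∪ Z)) (hb : ¬ ∃ g, OpenReach G a Z b g)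
    (hyx : G.Adj y x) : OpenReach G a Z y false := by
  by_cases hZ : x ∈ ancestralSet G Z
  · cases f with
    | false => exact h.tail (.back (hf rfl) hyx)
    | true => exact h.tail (.collider hZ hyx)
  · obtain ⟨w, (rfl | rfl) | hw, hxw⟩ := hx
    · exact (of_isAncestor_start hxw hZ).tail
        (.back (fun h => hZ (subset_ancestralSet h)) hyx)
    · exact absurd (h.of_isAncestor hxw hZ) hb
    · exact absurd ⟨w, hw, hxw⟩ hZ

theorem of_moralAdj {f : Bool} (h : OpenReach G a Z x f)
    (hx : x ∈ ancestralSet G ({a, b} ∪ Z) \ Z) (hy : y ∈ ancestralSet G ({a, b} ∪ Z))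
    (hxy : MoralAdj G (ancestralSet G ({a, b} ∪ Z)) x y) (hb : ¬ ∃ g, OpenReach G a Z b g) :
    ∃ g, OpenReach G a Z y g := by
  have hchild : ∀ d ∈ ancestralSet G ({a, b} ∪ Z), IsCommonChild G x y d →
      ∃ g, OpenReach G a Z y g := fun d hd hcd =>
    ⟨_, against (h.tail (.out hx.2 hcd.1)) Bool.noConfusion hd hb hcd.2⟩
  rcases hxy with ⟨-, (hadj | hadj) | ⟨d, hcd, hd⟩⟩ | ⟨d, hd, hcd⟩
  · exact ⟨_, h.tail (.out hx.2 hadj)⟩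
  · exact ⟨_, h.against (fun _ => hx.2) hx.1 hb hadj⟩
  · refine hchild d (hd.elim (fun hd => ?_) fun hd => ?_) hcd
    · exact mem_ancestralSet_of_isAncestor hd hx.1
    · exact mem_ancestralSet_of_isAncestor hd hy
  · exact hchild d hd hcd

end OpenReach

theorem MoralConn.exists_openReach (h : MoralConn G a b Z) : ∃ f, OpenReach G a Z b f := by
  by_contra hb
  suffices key : ∀ y, ReflTransGen (MoralStep G (ancestralSet G ({a, b} ∪ Z)) Z) a y →
      ∃ f, OpenReach G a Z y f from hb (key b h)
  intro y hy
  induction hy with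
  | refl => exact ⟨_, .refl⟩
  | tail _ hstep ih =>
    obtain ⟨f, hf⟩ := ih
    exact hf.of_moralAdj hstep.1 hstep.2.1.1 hstep.2.2 hb

theorem dConnected_iff_moralConn (ha : a ∉ Z) (hb : b ∉ Z) :
    DConnected G a b Z ↔ MoralConn G a b Z := by
  constructor
  · intro h
    obtain ⟨f, hf⟩ := h.exists_openStep ha
    exact moralConn_of_openStep hb hf
  · intro h
    obtain ⟨f, hf⟩ := h.exists_openReach
    exact dConnected_of_openStep hf

theorem not_dSep_singleton_iff (ha : a ∉ Z) (hb : b ∉ Z) :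
    ¬ DSep G {a} {b} Z ↔ MoralConn G a b Z := by
  simp only [DSep, Set.mem_singleton_iff, forall_eq, not_not, dConnected_iff_moralConn ha hb]

end Moral

/-! ### The cyclic equivalence theorem -/

section Compatible

variable {V : Type*} {G H : Digraph V} {a b c : V}

/-- `b` is a descendant of a common child of `a` and `c`. -/
def BelowCommonChild (G : Digraph V) (a b c : V) : Prop :=
  ∃ d, IsCommonChild G a c d ∧ IsAncestor G d b

namespace BelowCommonChild

theorem trans {b' : V} (h : BelowCommonChild G a b c) (hb : IsAncestor G b b') :
    BelowCommonChild G a b' c :=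
  let ⟨d, hd, hdb⟩ := h
  ⟨d, hd, hdb.trans hb⟩

theorem not_isAncestor (h : BelowCommonChild G a b c) (hne : a ≠ c) (hac : ¬ PAdj G a c) :
    ¬ IsAncestor G b a ∧ ¬ IsAncestor G b c := by
  obtain ⟨d, hd, hdb⟩ := h
  exact ⟨fun hba => hac ⟨hne, Or.inr ⟨d, hd, Or.inl (hdb.trans hba)⟩⟩,
    fun hbc => hac ⟨hne, Or.inr ⟨d, hd, Or.inr (hdb.trans hbc)⟩⟩⟩

end BelowCommonChild

/-- `a` and `c` are p-adjacent to `b`, but not to each other. -/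
structure IsUnshieldedTriple (G : Digraph V) (a b c : V) : Prop where
  ne : a ≠ c
  left : PAdj G a b
  right : PAdj G c b
  not_pAdj : ¬ PAdj G a c

theorem isUnshieldedTriple_congr (h : ∀ a b, PAdj G a b ↔ PAdj H a b) :
    IsUnshieldedTriple G a b c ↔ IsUnshieldedTriple H a b c := by
  constructor
  · exact fun ⟨hne, hl, hr, hn⟩ => ⟨hne, (h _ _).1 hl, (h _ _).1 hr, mt (h _ _).2 hn⟩
  · exact fun ⟨hne, hl, hr, hn⟩ => ⟨hne, (h _ _).2 hl, (h _ _).2 hr, mt (h _ _).1 hn⟩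

theorem IsCommonChild.isUnshieldedTriple {d : V} (h : IsCommonChild G a c d) (hne : a ≠ c)
    (hac : ¬ PAdj G a c) : IsUnshieldedTriple G a d c := by
  obtain ⟨hda, hdc⟩ := BelowCommonChild.not_isAncestor ⟨d, h, .refl⟩ hne hac
  exact ⟨hne, .of_adj (by rintro rfl; exact hda .refl) h.1,
    .of_adj (by rintro rfl; exact hdc .refl) h.2, hac⟩

/-- The invariants in Richardson's characterization of Markov equivalence agree for `G` and `H`:
p-adjacencies, the unshielded triples `(a, b, c)` with `b` below a common child of `a` and `c`,
mutual chains, and the ancestral relation from mutual chains to the remaining vertices that are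
p-adjacent to both ends. -/
structure Compatible (G H : Digraph V) : Prop where
  pAdj : ∀ a b, PAdj G a b ↔ PAdj H a b
  below : ∀ a b c, IsUnshieldedTriple G a b c →
    (BelowCommonChild G a b c ↔ BelowCommonChild H a b c)
  chain : ∀ t x, IsMutualChain (PAdj G) (IsAncestor G) t x ↔
    IsMutualChain (PAdj H) (IsAncestor H) t x
  ancestor : ∀ t x b, IsMutualChain (PAdj G) (IsAncestor G) t x → PAdj G (x 0) b →
    PAdj G (x (t + 1)) b → ¬ BelowCommonChild G (x 0) b (x (t + 1)) →
    (IsAncestor G (x 1) b ↔ IsAncestor H (x 1) b)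

/-- A step of a walk from `a` along p-adjacencies that is directed in `G` from its second step on
and stays in `T`. -/
def DescentStep (G : Digraph V) (T : Set V) (a x y : V) : Prop :=
  PAdj G x y ∧ (x = a ∨ IsAncestor G x y) ∧ y ∈ T

theorem IsInducedPath.isAncestor_of_descentStep {T : Set V} {m i j : ℕ} {v : ℕ → V}
    (hv : IsInducedPath (DescentStep G T (v 0)) m v) (hi : 1 ≤ i) (hij : i ≤ j) (hj : j ≤ m) :
    IsAncestor G (v i) (v j) :=
  rel_of_forall_rel_succ hij fun k hik hkj =>
    (hv.step k (by omega)).2.1.resolve_left (hv.ne 0 k (by omega) (by omega)).symm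

theorem IsInducedPath.not_pAdj_of_descentStep {T : Set V} {m i j : ℕ} {v : ℕ → V}
    (hv : IsInducedPath (DescentStep G T (v 0)) m v) (hij : i + 2 ≤ j) (hj : j ≤ m) :
    ¬ PAdj G (v i) (v j) := by
  obtain ⟨l, rfl⟩ : ∃ l, j = l + 1 := ⟨j - 1, by omega⟩
  refine fun hadj => hv.not_step i (l + 1) hij hj ⟨hadj, ?_, (hv.step l (by omega)).2.2⟩
  rcases i.eq_zero_or_pos with rfl | hi
  · exact Or.inl rfl
  · exact Or.inr (hv.isAncestor_of_descentStep hi (by omega) hj)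

namespace Compatible

theorem symm (h : Compatible G H) : Compatible H G where
  pAdj a b := (h.pAdj a b).symm
  below a b c htriple :=
    (h.below a b c ((isUnshieldedTriple_congr h.pAdj).2 htriple)).symm
  chain t x := (h.chain t x).symm
  ancestor t x b hx h0 h1 hb := by
    rw [← h.chain t x] at hx
    rw [← h.pAdj] at h0 h1
    rw [← h.below _ _ _ ⟨hx.ne_ends, h0, h1, hx.not_adj_ends⟩] at hb
    exact (h.ancestor t x b hx h0 h1 hb).symm

section Descent

variable {T : Set V} {s y e : V}

/-- Otherwise a shortest descent to `e` would contain a mutual chain of `H`, hence one of `G`, in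
which the inner vertices are not ancestors of the last one. -/
theorem mem_of_descent (h : Compatible G H) (hT : ∀ ⦃x y⦄, IsAncestor H x y → x ∈ T → y ∈ T)
    (ha : a ∉ T) (hay : ReflTransGen (DescentStep G T a) a y) (hye : G.Adj y e) (hne : y ≠ e)
    (hae : a ≠ e) (hnadj : ¬ PAdj G a e) : e ∈ T := by
  by_contra he
  have hwalk : ReflTransGen (DescentStep G (insert e T) a) a e :=
    (ReflTransGen.mono (fun _ _ hxy => ⟨hxy.1, hxy.2.1, Or.inr hxy.2.2⟩) _ _ hay).tail
      ⟨.of_adj hne hye, Or.inr (.single hye), Or.inl rfl⟩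
  obtain ⟨m, v, rfl, rfl, hve, hv⟩ := exists_isInducedPath (Set.mem_singleton e) hwalk
  have hm : 1 < m := by
    rcases m with _ | _ | m
    · exact absurd rfl hae
    · exact absurd (hv.step 0 one_pos).1 hnadj
    · omega
  obtain ⟨k, t, hkt, -, hchain⟩ := exists_isMutualChain (adj := PAdj H) (le := IsAncestor H)
    (U := Tᶜ) (fun _ _ hxy hy hx => hy (hT hxy hx)) ha he hm.le
    (not_not.2 ((hv.step 0 (by omega)).2.2.resolve_left (hve 1 hm)))
    (fun i hi _ => (h.pAdj _ _).1 (hv.step i hi).1)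
    (fun i j hij hj => mt (h.pAdj _ _).2 (hv.not_pAdj_of_descentStep hij hj)) hv.ne
  have ht := hchain.pos
  exact ((h.chain t _).2 hchain).not_le_right
    (hv.isAncestor_of_descentStep (by omega) (by omega) (by omega))

theorem mem_of_isAncestor (h : Compatible G H)
    (hT : ∀ ⦃x y⦄, IsAncestor H x y → x ∈ T → y ∈ T) (ha : a ∉ T) (hc : c ∉ T) (hs : s ∈ T)
    (has : ReflTransGen (DescentStep G T a) a s) (hcs : ReflTransGen (DescentStep G T c) c s)
    (hsa : ¬ IsAncestor G s a) (hsc : ¬ IsAncestor G s c)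
    (hmem : ∀ e, IsAncestor G s e → IsAncestor G e y → PAdj G a e → PAdj G c e → e ∈ T)
    (hsy : IsAncestor G s y) : y ∈ T := by
  suffices key : y ∈ T ∧ ReflTransGen (DescentStep G T a) a y ∧
      ReflTransGen (DescentStep G T c) c y from key.1
  induction hsy with
  | refl => exact ⟨hs, has, hcs⟩
  | @tail y e hsy hye ih =>
    obtain ⟨hy, hay, hcy⟩ := ih fun w hsw hwy => hmem w hsw (hwy.tail hye)
    by_cases hne : y = e
    · exact hne ▸ ⟨hy, hay, hcy⟩
    have hse : IsAncestor G s e := hsy.tail hye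
    have he : e ∈ T := by
      by_cases hae : PAdj G a e
      · by_cases hce : PAdj G c e
        · exact hmem e hse .refl hae hce
        · exact h.mem_of_descent hT hc hcy hye hne (by rintro rfl; exact hsc hse) hce
      · exact h.mem_of_descent hT ha hay hye hne (by rintro rfl; exact hsa hse) hae
    exact ⟨he, hay.tail ⟨.of_adj hne hye, Or.inr (.single hye), he⟩,
      hcy.tail ⟨.of_adj hne hye, Or.inr (.single hye), he⟩⟩

end Descent

theorem isAncestor_of_isMutualChain (h : Compatible G H) {t : ℕ} {x : ℕ → V}
    (hx : IsMutualChain (PAdj G) (IsAncestor G) t x) {y : V} (hy : IsAncestor G (x 1) y)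
    (hb : ¬ BelowCommonChild G (x 0) y (x (t + 1))) : IsAncestor H (x 1) y := by
  have hxH := (h.chain t x).1 hx
  refine h.mem_of_isAncestor (T := {v | IsAncestor H (x 1) v}) (fun _ _ hxy h1x => h1x.trans hxy)
    hxH.not_le_left hxH.not_le_right .refl ?_ ?_ hx.not_le_left hx.not_le_right
    (fun e he hey h0 h1 => (h.ancestor t x e hx h0 h1 fun he => hb (he.trans hey)).1 he) hy
  · exact .single ⟨hx.step 0 (by omega), Or.inl rfl, .refl⟩
  · have hback := rel_of_forall_rel_succ (r := ReflTransGen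
        (DescentStep G {v | IsAncestor H (x 1) v} (x (t + 1)))) (v := fun k => x (t + 1 - k))
      t.zero_le fun k _ hk => .single ⟨?_, ?_, (hxH.equiv _ (by omega) (by omega)).2⟩
    · simpa only [Nat.sub_zero, Nat.add_sub_cancel_left] using hback
    · have hstep := hx.step (t + 1 - (k + 1)) (by omega)
      rw [show t + 1 - (k + 1) + 1 = t + 1 - k by omega] at hstep
      exact hstep.symm
    · rcases k.eq_zero_or_pos with rfl | hk0
      · exact Or.inl rfl
      · exact Or.inr (hx.le_of_inner (by omega) (by omega) (by omega) (by omega))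

theorem belowCommonChild (h : Compatible G H) (hne : a ≠ c) (hac : ¬ PAdj G a c)
    (hb : BelowCommonChild G a b c) : BelowCommonChild H a b c := by
  obtain ⟨d, hd, hdb⟩ := hb
  have hacH : ¬ PAdj H a c := mt (h.pAdj a c).2 hac
  have hbelow {e : V} (he : IsAncestor G d e) : BelowCommonChild G a e c := ⟨d, hd, he⟩
  obtain ⟨hda, hdc⟩ := (hbelow .refl).not_isAncestor hne hac
  have hadc := hd.isUnshieldedTriple hne hac
  have hdH : BelowCommonChild H a d c := (h.below a d c hadc).1 (hbelow .refl)
  exact h.mem_of_isAncestor (T := {v | BelowCommonChild H a v c}) (fun _ _ hxy hx => hx.trans hxy)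
    (fun ha => (ha.not_isAncestor hne hacH).1 .refl)
    (fun hc => (hc.not_isAncestor hne hacH).2 .refl) hdH
    (.single ⟨hadc.left, Or.inl rfl, hdH⟩) (.single ⟨hadc.right, Or.inl rfl, hdH⟩) hda hdc
    (fun e he _ hae hce => (h.below a e c ⟨hne, hae, hce, hac⟩).1 (hbelow he)) hdb

theorem exists_isCommonChild (h : Compatible G H) {S : Set V} {x y : V} (hne : x ≠ y)
    (hnadj : ¬ PAdj G x y) (hxy : MoralAdj G (ancestralSet G S) x y) :
    ∃ d ∈ ancestralSet H S, IsCommonChild H x y d := by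
  obtain ⟨d, ⟨s, hs, hds⟩, hd⟩ := hxy.resolve_left hnadj
  obtain ⟨d', hd', hds'⟩ := h.belowCommonChild hne hnadj ⟨d, hd, hds⟩
  exact ⟨d', ⟨s, hs, hds'⟩, hd'⟩

theorem moralAdj (h : Compatible G H) {S : Set V} {x y : V} (hne : x ≠ y)
    (hxy : MoralAdj G (ancestralSet G S) x y) : MoralAdj H (ancestralSet H S) x y := by
  by_cases hadj : PAdj G x y
  · exact Or.inl ((h.pAdj x y).1 hadj)
  · exact Or.inr (h.exists_isCommonChild hne hadj hxy)

theorem mem_ancestralSet (h : Compatible G H) {S : Set V} {m i : ℕ} {v : ℕ → V}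
    (hv : IsInducedPath (MoralAdj G (ancestralSet G S)) m v)
    (hW : ∀ i ≤ m, v i ∈ ancestralSet G S) (h0 : v 0 ∈ S) (hm : v m ∈ S) (hi : i ≤ m) :
    v i ∈ ancestralSet H S := by
  by_contra hi'
  have hadj : ∀ i < m, v i ∉ ancestralSet H S ∨ v (i + 1) ∉ ancestralSet H S →
      PAdj H (v i) (v (i + 1)) := by
    intro i hi hor
    by_contra hnadj
    obtain ⟨d, hd, hcd⟩ := h.exists_isCommonChild (hv.ne i (i + 1) (by omega) (by omega))
      (mt (h.pAdj _ _).1 hnadj) (hv.step i hi)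
    exact hor.elim (fun h => h (mem_ancestralSet_of_isAncestor (.single hcd.1) hd))
      fun h => h (mem_ancestralSet_of_isAncestor (.single hcd.2) hd)
  obtain ⟨k, t, hkt, hout, hchain⟩ := exists_isMutualChain (le := IsAncestor H)
    (fun _ _ => mem_ancestralSet_of_isAncestor) (subset_ancestralSet h0) (subset_ancestralSet hm)
    hi hi' hadj (fun i j hij hj hH => hv.not_step i j hij hj (Or.inl ((h.pAdj _ _).2 hH))) hv.ne
  have ht := hchain.pos
  obtain ⟨s, hs, hks⟩ := hW (k + 1) (by omega)
  have hchainG := (h.chain t _).2 hchain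
  refine hout 1 le_rfl ht ⟨s, hs, h.isAncestor_of_isMutualChain hchainG hks ?_⟩
  rintro ⟨d, hcd, hds⟩
  exact hv.not_step _ _ (by omega) (by omega) (Or.inr ⟨d, ⟨s, hs, hds⟩, hcd⟩)

theorem moralConn (h : Compatible G H) {Z : Set V} (hG : MoralConn G a b Z) :
    MoralConn H a b Z := by
  obtain ⟨m, v, rfl, rfl, -, hv⟩ := exists_isInducedPath (Set.mem_singleton b) hG
  set S : Set V := {v 0, v m} ∪ Z
  have hW : ∀ i ≤ m, v i ∈ ancestralSet G S := by
    intro i hi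
    rcases hi.lt_or_eq with hi | rfl
    · exact (hv.step i hi).1.1
    · exact subset_ancestralSet (by simp [S])
  have hmoral : IsInducedPath (MoralAdj G (ancestralSet G S)) m v := by
    refine ⟨fun i hi => (hv.step i hi).2.2, fun i j hij hj hadj => ?_, hv.ne⟩
    obtain ⟨l, rfl⟩ : ∃ l, j = l + 1 := ⟨j - 1, by omega⟩
    exact hv.not_step i _ hij hj ⟨(hv.step i (by omega)).1, (hv.step l (by omega)).2.1, hadj⟩
  have hWH : ∀ i ≤ m, v i ∈ ancestralSet H S := fun i =>
    h.mem_ancestralSet hmoral hW (by simp [S]) (by simp [S])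
  exact rel_of_forall_rel_succ (r := ReflTransGen _) m.zero_le fun i _ hi => .single
    ⟨⟨hWH i hi.le, (hv.step i hi).1.2⟩, ⟨hWH _ hi, (hv.step i hi).2.1.2⟩,
      h.moralAdj (hv.ne i (i + 1) (by omega) hi) (hmoral.step i hi)⟩

theorem markovEquivalent (h : Compatible G H) : MarkovEquivalent G H := by
  intro A B Z _ hAZ hBZ
  refine forall₂_congr fun a ha => forall₂_congr fun b hb => not_congr ?_
  have haZ := hAZ.notMem_of_mem_left ha
  have hbZ := hBZ.notMem_of_mem_left hb
  rw [dConnected_iff_moralConn haZ hbZ, dConnected_iff_moralConn haZ hbZ]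
  exact ⟨h.moralConn, h.symm.moralConn⟩

end Compatible

end Compatible

/-! ### Partially ordered partitions and the true graph -/

section MoralConn

variable {V : Type*} {G : Digraph V} {a b c : V} {S Z : Set V}

theorem MoralConn.of_pAdj (h : PAdj G a b) (ha : a ∉ Z) (hb : b ∉ Z) : MoralConn G a b Z :=
  .single ⟨⟨subset_ancestralSet (by simp), ha⟩, ⟨subset_ancestralSet (by simp), hb⟩, Or.inl h⟩

theorem MoralConn.of_belowCommonChild (h : BelowCommonChild G a b c) (ha : a ∉ Z) (hc : c ∉ Z)
    (hb : b ∈ Z) : MoralConn G a c Z :=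
  let ⟨d, hd, hdb⟩ := h
  .single ⟨⟨subset_ancestralSet (by simp), ha⟩, ⟨subset_ancestralSet (by simp), hc⟩,
    Or.inr ⟨d, ⟨b, Or.inr hb, hdb⟩, hd⟩⟩

theorem ancestralSet_ancestralSet : ancestralSet G (ancestralSet G S) = ancestralSet G S :=
  Set.Subset.antisymm (fun _ ⟨_, hs, hv⟩ => mem_ancestralSet_of_isAncestor hv hs)
    subset_ancestralSet

theorem moralConn_ancestralSet_diff_iff (hne : a ≠ c) (ha : a ∈ S) (hc : c ∈ S) :
    MoralConn G a c (ancestralSet G S \ {a, c}) ↔ MoralAdj G (ancestralSet G S) a c := by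
  have hac : {a, c} ⊆ ancestralSet G S :=
    Set.pair_subset (subset_ancestralSet ha) (subset_ancestralSet hc)
  have hW : ancestralSet G ({a, c} ∪ ancestralSet G S \ {a, c}) = ancestralSet G S := by
    rw [Set.union_sdiff_cancel hac, ancestralSet_ancestralSet]
  simp only [MoralConn, hW]
  constructor
  · intro h
    suffices key : ∀ y, ReflTransGen
        (MoralStep G (ancestralSet G S) (ancestralSet G S \ {a, c})) a y → y = c →
        MoralAdj G (ancestralSet G S) a c from key c h rfl
    intro y hay
    induction hay with
    | refl => exact fun h => absurd h hne
    | @tail x y _ hxy ih =>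
      rintro rfl
      have hx : x = a ∨ x = y := not_not.1 fun hx => hxy.1.2 ⟨hxy.1.1, hx⟩
      rcases hx with rfl | rfl
      · exact hxy.2.2
      · exact ih rfl
  · exact fun h => .single ⟨⟨hac (by simp), by simp⟩, ⟨hac (by simp), by simp⟩, h⟩

end MoralConn

namespace POPartition

variable {n : ℕ} {P : POPartition n} {a b c : Fin n} {S : Set (Fin n)}

/-- The preorder `C_a ≤ C_b` on the vertices. -/
def vle (P : POPartition n) (a b : Fin n) : Prop := P.le (P.sec a) (P.sec b)

instance (P : POPartition n) : IsPreorder (Fin n) P.vle where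
  refl _ := P.le_refl _
  trans _ _ _ := P.le_trans _ _ _

theorem sec_eq_sec_iff : P.sec a = P.sec b ↔ P.vle a b ∧ P.vle b a :=
  ⟨fun h => ⟨show P.le _ _ from h ▸ P.le_refl _, show P.le _ _ from h ▸ P.le_refl _⟩,
    fun h => P.le_antisymm _ _ h.1 h.2⟩

theorem mem_iff_sec_eq {C : P.partition.parts} : a ∈ C.1 ↔ P.sec a = C := by
  constructor
  · exact fun h => Subtype.ext (P.partition.part_eq_of_mem C.2 h)
  · rintro rfl
    exact P.partition.mem_part (Finset.mem_univ a)

theorem mem_down : a ∈ P.down S ↔ ∃ s ∈ S, P.vle a s := by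
  constructor
  · rintro ⟨C, ⟨s, hs, hC⟩, ha⟩
    obtain rfl := mem_iff_sec_eq.1 ha
    exact ⟨s, hs, hC⟩
  · rintro ⟨s, hs, h⟩
    exact ⟨P.sec a, ⟨s, hs, h⟩, mem_iff_sec_eq.2 rfl⟩

theorem subset_down : S ⊆ P.down S := fun s hs => mem_down.2 ⟨s, hs, refl _⟩

end POPartition

section Partitions

variable {n t : ℕ} {Gs : Digraph (Fin n)} {P : POPartition n} {a b c : Fin n} {S : Set (Fin n)}
  {x : ℕ → Fin n}

open POPartition

theorem vle_assocPOPartition : (assocPOPartition Gs).vle = IsAncestor Gs := by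
  have hmem : ∀ x, x ∈ ((assocPOPartition Gs).sec x).1 := fun _ => mem_iff_sec_eq.2 rfl
  have hrel : ∀ {x y}, y ∈ ((assocPOPartition Gs).sec x).1 ↔
      IsAncestor Gs x y ∧ IsAncestor Gs y x := fun {x _} =>
    mem_strongComponents_rel Gs ((assocPOPartition Gs).sec x).2 (hmem x)
  ext a b
  constructor
  · rintro (h | h)
    · exact (hrel.1 (h ▸ hmem b)).1
    · exact h a (hmem a) b (hmem b)
  · exact fun h => Or.inr fun x hx y hy => ((hrel.1 hx).2.trans h).trans (hrel.1 hy).1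

theorem down_assocPOPartition : (assocPOPartition Gs).down S = ancestralSet Gs S := by
  ext v
  rw [mem_down, vle_assocPOPartition]
  rfl

theorem mem_E1_iff : (a, b) ∈ E1 Gs P ↔
    a ≠ b ∧ MoralConn Gs a b (P.down {a, b} \ {a, b}) := by
  rw [← not_dSep_singleton_iff (by simp) (by simp)]
  rfl

theorem mem_E1_of_pAdj (h : PAdj Gs a b) : (a, b) ∈ E1 Gs P :=
  mem_E1_iff.2 ⟨h.1, .of_pAdj h (by simp) (by simp)⟩

/-- The pairs in `E⁽¹⁾` are the pairs of p-adjacent vertices of the true graph. -/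
def RecoversPAdj (Gs : Digraph (Fin n)) (P : POPartition n) : Prop :=
  ∀ a b, (a, b) ∈ E1 Gs P ↔ PAdj Gs a b

theorem recoversPAdj_assocPOPartition (Gs : Digraph (Fin n)) :
    RecoversPAdj Gs (assocPOPartition Gs) := by
  refine fun a b => ⟨fun h => ?_, mem_E1_of_pAdj⟩
  obtain ⟨hne, h⟩ := mem_E1_iff.1 h
  rw [down_assocPOPartition, moralConn_ancestralSet_diff_iff hne (by simp) (by simp)] at h
  obtain h | ⟨d, ⟨_, rfl | rfl, hd⟩, hab⟩ := h
  · exact h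
  · exact ⟨hne, Or.inr ⟨d, hab, Or.inl hd⟩⟩
  · exact ⟨hne, Or.inr ⟨d, hab, Or.inr hd⟩⟩

/-- The mutual chains of `P` for the p-adjacencies of the true graph. -/
abbrev POPartition.IsChain (Gs : Digraph (Fin n)) (P : POPartition n) (t : ℕ) (x : ℕ → Fin n) :
    Prop := IsMutualChain (PAdj Gs) P.vle t x

theorem isChain_one_iff : P.IsChain Gs 1 x ↔
    IsUnshieldedTriple Gs (x 0) (x 1) (x 2) ∧ ¬ P.LeMax (x 1) (x 0) (x 2) := by
  constructor
  · exact fun h => ⟨⟨h.ne_ends, h.step 0 (by omega), (h.step 1 (by omega)).symm, h.not_adj_ends⟩,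
      fun hle => hle.elim h.not_le_left h.not_le_right⟩
  · rintro ⟨⟨hne, hl, hr, hn⟩, hle⟩
    refine ⟨⟨fun i hi => ?_, fun i j hij hj => ?_, fun i j hij hj => ?_⟩, fun i h1 hi => ?_,
      fun h => hle (Or.inl h), fun h => hle (Or.inr h)⟩
    · interval_cases i
      exacts [hl, hr.symm]
    · obtain ⟨rfl, rfl⟩ : i = 0 ∧ j = 2 := by omega
      exact hn
    · obtain ⟨rfl, rfl⟩ | ⟨rfl, rfl⟩ | ⟨rfl, rfl⟩ :
        (i = 0 ∧ j = 1) ∨ (i = 0 ∧ j = 2) ∨ (i = 1 ∧ j = 2) := by omega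
      exacts [hl.1, hne, hr.1.symm]
    · obtain rfl : i = 1 := by omega
      exact ⟨refl _, refl _⟩

/-- The inner vertices of the chain lie outside the conditioning set. -/
theorem POPartition.IsChain.moralConn (h : P.IsChain Gs t x)
    (hS : ∀ s ∈ S, ¬ P.vle (x 1) s) (hanc : ∀ i, 1 ≤ i → i ≤ t → x i ∈ ancestralSet Gs S) :
    MoralConn Gs (x 0) (x (t + 1)) (P.down S \ {x 0, x (t + 1)}) := by
  have hsub : S ⊆ {x 0, x (t + 1)} ∪ P.down S \ {x 0, x (t + 1)} := fun s hs => by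
    by_cases he : s ∈ ({x 0, x (t + 1)} : Set (Fin n))
    exacts [Or.inl he, Or.inr ⟨subset_down hs, he⟩]
  have hmem : ∀ i ≤ t + 1, x i ∈ ancestralSet Gs ({x 0, x (t + 1)} ∪ P.down S \ {x 0, x (t + 1)}) \
      (P.down S \ {x 0, x (t + 1)}) := by
    intro i hi
    obtain rfl | rfl | hi : i = 0 ∨ i = t + 1 ∨ (1 ≤ i ∧ i ≤ t) := by omega
    · exact ⟨subset_ancestralSet (by simp), by simp⟩
    · exact ⟨subset_ancestralSet (by simp), by simp⟩
    · refine ⟨ancestralSet_mono hsub (hanc i hi.1 hi.2), fun hd => ?_⟩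
      obtain ⟨s, hs, his⟩ := mem_down.1 hd.1
      exact hS s hs (_root_.trans (h.equiv i hi.1 hi.2).2 his)
  exact rel_of_forall_rel_succ (r := ReflTransGen _) (t + 1).zero_le fun i _ hi =>
    .single ⟨hmem i hi.le, hmem (i + 1) hi, Or.inl (h.step i hi)⟩

theorem exists_eq_restrict {α : Type*} {m : ℕ} (a : Fin (m + 1) → α) :
    ∃ x : ℕ → α, a = fun i : Fin (m + 1) => x i :=
  ⟨fun i => a (Fin.ofNat (m + 1) i), by simp only [Fin.ofNat_val_eq_self]⟩

namespace RecoversPAdj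

theorem mem_E2_iff (h : RecoversPAdj Gs P) : (a, b, c) ∈ E2 Gs P ↔
    IsUnshieldedTriple Gs a b c ∧ P.LeMax b a c := by
  have : (a, b, c) ∈ E2 Gs P ↔ (a ≠ b ∧ b ≠ c ∧ a ≠ c) ∧ (a, b) ∈ E1 Gs P ∧ (c, b) ∈ E1 Gs P ∧
    (a, c) ∉ E1 Gs P ∧ P.LeMax b a c := Iff.rfl
  rw [this, h, h, h]
  exact ⟨fun ⟨hne, hl, hr, hn, hle⟩ => ⟨⟨hne.2.2, hl, hr, hn⟩, hle⟩,
    fun ⟨⟨hne, hl, hr, hn⟩, hle⟩ => ⟨⟨hl.1, hr.1.symm, hne⟩, hl, hr, hn, hle⟩⟩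

theorem mem_E3_iff (h : RecoversPAdj Gs P) : (a, b, c) ∈ E3 Gs P ↔
    IsUnshieldedTriple Gs a b c ∧ MoralConn Gs a c (P.down {a, b, c} \ {a, c}) := by
  rw [← not_dSep_singleton_iff (by simp) (by simp)]
  have : (a, b, c) ∈ E3 Gs P ↔ (a ≠ b ∧ b ≠ c ∧ a ≠ c) ∧ (a, b) ∈ E1 Gs P ∧ (c, b) ∈ E1 Gs P ∧
    (a, c) ∉ E1 Gs P ∧ ¬ DSep Gs {a} {c} (P.down {a, b, c} \ {a, c}) := Iff.rfl
  rw [this, h, h, h]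
  exact ⟨fun ⟨hne, hl, hr, hn, hc⟩ => ⟨⟨hne.2.2, hl, hr, hn⟩, hc⟩,
    fun ⟨⟨hne, hl, hr, hn⟩, hc⟩ => ⟨⟨hl.1, hr.1.symm, hne⟩, hl, hr, hn, hc⟩⟩

theorem mem_E3_of_belowCommonChild (h : RecoversPAdj Gs P) (htriple : IsUnshieldedTriple Gs a b c)
    {b' : Fin n} (hb' : BelowCommonChild Gs a b' c) (hle : P.vle b' b) : (a, b, c) ∈ E3 Gs P := by
  have hn := hb'.not_isAncestor htriple.ne htriple.not_pAdj
  refine h.mem_E3_iff.2 ⟨htriple, .of_belowCommonChild hb' (by simp) (by simp)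
    ⟨mem_down.2 ⟨b, by simp, hle⟩, ?_⟩⟩
  rintro (rfl | rfl)
  exacts [hn.1 .refl, hn.2 .refl]

end RecoversPAdj

theorem mem_E3_assocPOPartition_iff : (a, b, c) ∈ E3 Gs (assocPOPartition Gs) ↔
    IsUnshieldedTriple Gs a b c ∧ BelowCommonChild Gs a b c := by
  have hrec := recoversPAdj_assocPOPartition Gs
  constructor
  · rw [hrec.mem_E3_iff, down_assocPOPartition]
    rintro ⟨htriple, h⟩
    refine ⟨htriple, ?_⟩
    rw [moralConn_ancestralSet_diff_iff htriple.ne (by simp) (by simp)] at h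
    obtain ⟨d, ⟨_, rfl | rfl | rfl, hd⟩, hac⟩ := h.resolve_left htriple.not_pAdj
    · exact absurd ⟨htriple.ne, Or.inr ⟨d, hac, Or.inl hd⟩⟩ htriple.not_pAdj
    · exact ⟨d, hac, hd⟩
    · exact absurd ⟨htriple.ne, Or.inr ⟨d, hac, Or.inr hd⟩⟩ htriple.not_pAdj
  · exact fun ⟨htriple, h⟩ => hrec.mem_E3_of_belowCommonChild htriple h (refl b)

namespace RecoversPAdj

theorem mem_D_iff (h : RecoversPAdj Gs P) :
    (fun i : Fin (t + 2) => x i) ∈ D Gs P t ↔ P.IsChain Gs t x := by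
  have hone : ((1 : Fin (t + 2)) : ℕ) = 1 := by simp
  simp only [D, Set.mem_ofPred_eq, POPartition.LeMax, h _ _, sec_eq_sec_iff, hone, Fin.val_last,
    Fin.val_zero, Fin.val_castSucc, Fin.val_succ]
  constructor
  · rintro ⟨hinj, hstep, hnot, hequiv, hle⟩
    exact ⟨⟨fun i hi => hstep ⟨i, hi⟩,
        fun i j hij hj hadj => hnot ⟨j, by omega⟩ ⟨i, by omega⟩ hij hadj.symm,
        fun i j hij hj he => hij.ne (Fin.mk.inj
          (hinj (a₁ := ⟨i, by omega⟩) (a₂ := ⟨j, by omega⟩) he))⟩,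
      fun i h1 hi => hequiv ⟨i, by omega⟩ h1 hi, fun h => hle (Or.inl h), fun h => hle (Or.inr h)⟩
  · exact fun hx => ⟨hx.injective, fun i => hx.step i i.isLt,
      fun i j hji hadj => hx.not_step j i hji (by omega) hadj.symm,
      fun i h1 hi => hx.equiv i h1 hi, fun hle => hle.elim hx.not_le_left hx.not_le_right⟩

theorem mem_E6_iff (h : RecoversPAdj Gs P) :
    (⟨t, fun i : Fin (t + 2) => x i, (x 0, b, x (t + 1))⟩ :
      Σ t : ℕ, (Fin (t + 2) → Fin n) × (Fin n × Fin n × Fin n)) ∈ E6 Gs P ↔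
    P.IsChain Gs t x ∧ PAdj Gs (x 0) b ∧ PAdj Gs (x (t + 1)) b ∧
      (x 0, b, x (t + 1)) ∉ E3 Gs P ∧ P.vle (x 1) b := by
  have hone : ((1 : Fin (t + 2)) : ℕ) = 1 := by simp
  constructor
  · rintro ⟨t', a, b', he, -, -, -, h0, h1, -, h3, hD, hle⟩
    obtain rfl : t = t' := congrArg Sigma.fst he
    simp only [Sigma.mk.injEq, heq_eq_eq, Prod.mk.injEq, true_and] at he
    obtain ⟨rfl, -, rfl, -⟩ := he
    rw [h] at h0 h1
    simp only [hone] at hle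
    exact ⟨h.mem_D_iff.1 hD, h0, h1, h3, hle⟩
  · rintro ⟨hx, h0, h1, h3, hle⟩
    refine ⟨t, fun i => x i, b, rfl, hx.pos, by simpa using hx.add_two_le_card,
      ⟨h0.1, h1.1.symm, hx.ne_ends⟩, (h _ _).2 h0, (h _ _).2 h1, fun h2 => ?_, h3,
      h.mem_D_iff.2 hx, by simp only [hone]; exact hle⟩
    rcases (h.mem_E2_iff.1 h2).2 with hb | hb
    · exact hx.not_le_left (_root_.trans hle hb)
    · exact hx.not_le_right (_root_.trans hle hb)

theorem exists_notMem_ancestralSet (h : RecoversPAdj Gs P) (hx : P.IsChain Gs t x) :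
    ∃ i, 1 ≤ i ∧ i ≤ t ∧ x i ∉ ancestralSet Gs {x 0, x (t + 1)} := by
  by_contra! hanc
  refine hx.not_adj_ends ((h _ _).1 (mem_E1_iff.2 ⟨hx.ne_ends, hx.moralConn ?_ hanc⟩))
  rintro s (rfl | rfl)
  exacts [hx.not_le_left, hx.not_le_right]

theorem isChain_assocPOPartition_of_isChain (h : RecoversPAdj Gs P)
    (hlt : ∀ s < t, ∀ y, (assocPOPartition Gs).IsChain Gs s y → P.IsChain Gs s y)
    (hx : P.IsChain Gs t x) : (assocPOPartition Gs).IsChain Gs t x := by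
  obtain ⟨i, -, hit, hi⟩ := h.exists_notMem_ancestralSet hx
  obtain ⟨k, s, hks, -, hchain⟩ := exists_isMutualChain (m := t + 1) (le := IsAncestor Gs)
    (fun _ _ => mem_ancestralSet_of_isAncestor) (subset_ancestralSet (by simp))
    (subset_ancestralSet (by simp)) (by omega) hi (fun i hi _ => hx.step i hi) hx.not_step hx.ne
  rw [← vle_assocPOPartition] at hchain
  rcases (show s ≤ t by omega).lt_or_eq with hst | rfl
  · exact absurd (hx.eq_of_segment (by omega) (hlt s hst _ hchain)).2 hst.ne
  · obtain rfl : k = 0 := by omega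
    simpa only [Nat.zero_add] using hchain

theorem vle_of_isAncestor (h : RecoversPAdj Gs P) (hx : P.IsChain Gs t x)
    (hanc : ∀ i, 1 ≤ i → i ≤ t → IsAncestor Gs (x i) b) (h0 : PAdj Gs (x 0) b)
    (h1 : PAdj Gs (x (t + 1)) b) (h3 : (x 0, b, x (t + 1)) ∉ E3 Gs P) : P.vle (x 1) b := by
  by_contra hb
  refine h3 (h.mem_E3_iff.2 ⟨⟨hx.ne_ends, h0, h1, hx.not_adj_ends⟩,
    hx.moralConn ?_ fun i hi hit => ⟨b, by simp, hanc i hi hit⟩⟩)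
  rintro s (rfl | rfl | rfl)
  exacts [hx.not_le_left, hb, hx.not_le_right]

theorem isChain_of_notMem_E2 (h : RecoversPAdj Gs P) (htriple : IsUnshieldedTriple Gs a b c)
    (h2 : (a, b, c) ∉ E2 Gs P) : P.IsChain Gs 1 (consSeq a (consSeq b fun _ => c)) :=
  isChain_one_iff.2 ⟨htriple, fun hle => h2 (h.mem_E2_iff.2 ⟨htriple, hle⟩)⟩

theorem E2_subset (h : RecoversPAdj Gs P) : E2 Gs (assocPOPartition Gs) ⊆ E2 Gs P := by
  rintro ⟨a, b, c⟩ habc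
  obtain ⟨htriple, hle⟩ := (recoversPAdj_assocPOPartition Gs).mem_E2_iff.1 habc
  by_contra h2
  have hchain := h.isChain_assocPOPartition_of_isChain
    (fun s hs y hy => absurd hy.pos (by omega)) (h.isChain_of_notMem_E2 htriple h2)
  exact (isChain_one_iff.1 hchain).2 hle

theorem E3_subset (h : RecoversPAdj Gs P) : E3 Gs (assocPOPartition Gs) ⊆ E3 Gs P := by
  rintro ⟨a, b, c⟩ habc
  obtain ⟨htriple, hb⟩ := mem_E3_assocPOPartition_iff.1 habc
  exact h.mem_E3_of_belowCommonChild htriple hb (refl b)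

theorem E4_subset (h : RecoversPAdj Gs P) (h2 : E2 Gs P = E2 Gs (assocPOPartition Gs))
    (h3 : E3 Gs P = E3 Gs (assocPOPartition Gs)) : E4 Gs (assocPOPartition Gs) ⊆ E4 Gs P := by
  rintro q ⟨a, b₁, b₂, c, rfl, hne₁, hne₂, hab₁, hcb₁, hab₂, hcb₂, hac, h2₁, h2₂, h3₁, h3₂, hle⟩
  have hrec := recoversPAdj_assocPOPartition Gs
  rw [← h2] at h2₁ h2₂
  rw [← h3] at h3₁ h3₂
  have hE1 : E1 Gs (assocPOPartition Gs) = E1 Gs P :=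
    Set.ext fun p => (hrec p.1 p.2).trans (h p.1 p.2).symm
  rw [hE1] at hab₁ hcb₁ hab₂ hcb₂ hac
  refine ⟨a, b₁, b₂, c, rfl, hne₁, hne₂, hab₁, hcb₁, hab₂, hcb₂, hac, h2₁, h2₂, h3₁, h3₂, ?_⟩
  rw [h] at hab₁ hcb₁ hab₂ hcb₂ hac
  have hanc : IsAncestor Gs b₁ b₂ := vle_assocPOPartition.le _ _ hle
  refine h.vle_of_isAncestor (h.isChain_of_notMem_E2 ⟨hne₁.2.2, hab₁, hcb₁, hac⟩ h2₁)
    (fun i h1 hi => ?_) hab₂ hcb₂ h3₂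
  obtain rfl : i = 1 := by omega
  exact hanc

theorem E6_subset (h : RecoversPAdj Gs P) (h3 : E3 Gs P = E3 Gs (assocPOPartition Gs))
    (hchain : ∀ t x, (assocPOPartition Gs).IsChain Gs t x → P.IsChain Gs t x) :
    E6 Gs (assocPOPartition Gs) ⊆ E6 Gs P := by
  intro q hq
  obtain ⟨t, a, b, rfl, -⟩ := id hq
  obtain ⟨x, rfl⟩ := exists_eq_restrict a
  obtain ⟨hx, h0, h1, hE3, hle⟩ := (recoversPAdj_assocPOPartition Gs).mem_E6_iff.1 hq
  rw [← h3] at hE3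
  refine h.mem_E6_iff.2 ⟨hchain t x hx, h0, h1, hE3,
    h.vle_of_isAncestor (hchain t x hx) (fun i hi hit => ?_) h0 h1 hE3⟩
  rw [← vle_assocPOPartition]
  exact _root_.trans (hx.equiv i hi hit).1 hle

end RecoversPAdj

end Partitions

/-! ### Optimal partitions -/

section Optimality

section General

variable {α β : Type*} {S : Set α} {F : α → Set β} {x : α}

theorem argmin_ncard_eq (hx : x ∈ S) (hfin : ∀ y ∈ S, (F y).Finite) (h : ∀ y ∈ S, F x ⊆ F y) :
    argmin S (fun y => (F y).ncard) = {y ∈ S | F y = F x} := by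
  ext y
  constructor
  · exact fun hy =>
      ⟨hy.1, (Set.eq_of_subset_of_ncard_le (h y hy.1) (hy.2 x hx) (hfin y hy.1)).symm⟩
  · exact fun ⟨hy, heq⟩ => ⟨hy, fun z hz =>
      (congrArg Set.ncard heq).trans_le (Set.ncard_le_ncard (h z hz) (hfin z hz))⟩

theorem argmax_ncard_eq (hx : x ∈ S) (hfin : (F x).Finite) (h : ∀ y ∈ S, F y ⊆ F x) :
    argmax S (fun y => (F y).ncard) = {y ∈ S | F y = F x} := by
  ext y
  constructor
  · exact fun hy => ⟨hy.1, Set.eq_of_subset_of_ncard_le (h y hy.1) (hy.2 x hx) hfin⟩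
  · exact fun ⟨hy, heq⟩ => ⟨hy, fun z hz =>
      (Set.ncard_le_ncard (h z hz) hfin).trans_eq (congrArg Set.ncard heq).symm⟩

end General

variable {n t : ℕ} {Gs : Digraph (Fin n)} {P : POPartition n}

theorem mem_S1_iff : P ∈ S1 Gs ↔ RecoversPAdj Gs P := by
  have hrec := recoversPAdj_assocPOPartition Gs
  rw [S1, argmin_ncard_eq (F := E1 Gs) (Set.mem_univ (assocPOPartition Gs))
    (fun _ _ => Set.toFinite _) fun P _ p hp => mem_E1_of_pAdj ((hrec p.1 p.2).1 hp)]
  constructor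
  · rintro ⟨-, h⟩ a b
    rw [h, hrec]
  · exact fun h => ⟨Set.mem_univ P, Set.ext fun p => (h p.1 p.2).trans (hrec p.1 p.2).symm⟩

theorem mem_S2_iff : P ∈ S2 Gs ↔ P ∈ S1 Gs ∧ E2 Gs P = E2 Gs (assocPOPartition Gs) := by
  rw [S2, argmin_ncard_eq (mem_S1_iff.2 (recoversPAdj_assocPOPartition Gs))
    (fun _ _ => Set.toFinite _) fun P hP => (mem_S1_iff.1 hP).E2_subset]
  rfl

theorem mem_S3_iff : P ∈ S3 Gs ↔ P ∈ S2 Gs ∧ E3 Gs P = E3 Gs (assocPOPartition Gs) := by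
  rw [S3, argmin_ncard_eq
    (mem_S2_iff.2 ⟨mem_S1_iff.2 (recoversPAdj_assocPOPartition Gs), rfl⟩)
    (fun _ _ => Set.toFinite _) fun P hP => (mem_S1_iff.1 (mem_S2_iff.1 hP).1).E3_subset]
  rfl

theorem mem_S3_iff_recoversPAdj : P ∈ S3 Gs ↔ RecoversPAdj Gs P ∧
    E2 Gs P = E2 Gs (assocPOPartition Gs) ∧ E3 Gs P = E3 Gs (assocPOPartition Gs) := by
  rw [mem_S3_iff, mem_S2_iff, mem_S1_iff, and_assoc]

theorem mem_S4_iff : P ∈ S4 Gs ↔ P ∈ S3 Gs ∧ E4 Gs P = E4 Gs (assocPOPartition Gs) := by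
  rw [S4, argmin_ncard_eq
    (mem_S3_iff_recoversPAdj.2 ⟨recoversPAdj_assocPOPartition Gs, rfl, rfl⟩)
    (fun _ _ => Set.toFinite _) fun P hP =>
      let ⟨hrec, h2, h3⟩ := mem_S3_iff_recoversPAdj.1 hP
      hrec.E4_subset h2 h3]
  rfl

theorem assocPOPartition_mem_S4 : assocPOPartition Gs ∈ S4 Gs :=
  mem_S4_iff.2 ⟨mem_S3_iff_recoversPAdj.2 ⟨recoversPAdj_assocPOPartition Gs, rfl, rfl⟩, rfl⟩

theorem recoversPAdj_of_mem_S4 (hP : P ∈ S4 Gs) : RecoversPAdj Gs P :=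
  (mem_S3_iff_recoversPAdj.1 (mem_S4_iff.1 hP).1).1

theorem isChain_one_iff_of_mem_S4 (hP : P ∈ S4 Gs) (x : ℕ → Fin n) :
    P.IsChain Gs 1 x ↔ (assocPOPartition Gs).IsChain Gs 1 x := by
  obtain ⟨hrec, h2, -⟩ := mem_S3_iff_recoversPAdj.1 (mem_S4_iff.1 hP).1
  have htriple := Set.ext_iff.1 h2 (x 0, x 1, x 2)
  rw [hrec.mem_E2_iff, (recoversPAdj_assocPOPartition Gs).mem_E2_iff] at htriple
  rw [isChain_one_iff, isChain_one_iff]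
  tauto

theorem RecoversPAdj.D_eq_iff (h : RecoversPAdj Gs P) : D Gs P t = D Gs (assocPOPartition Gs) t ↔
    ∀ x, P.IsChain Gs t x ↔ (assocPOPartition Gs).IsChain Gs t x := by
  constructor
  · intro hD x
    rw [← h.mem_D_iff, hD, (recoversPAdj_assocPOPartition Gs).mem_D_iff]
  · intro hchain
    ext a
    obtain ⟨x, rfl⟩ := exists_eq_restrict a
    rw [h.mem_D_iff, hchain, (recoversPAdj_assocPOPartition Gs).mem_D_iff]

theorem RecoversPAdj.D_subset (h : RecoversPAdj Gs P)
    (hlt : ∀ s < t, ∀ y, (assocPOPartition Gs).IsChain Gs s y → P.IsChain Gs s y) :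
    D Gs P t ⊆ D Gs (assocPOPartition Gs) t := by
  intro a ha
  obtain ⟨x, rfl⟩ := exists_eq_restrict a
  exact (recoversPAdj_assocPOPartition Gs).mem_D_iff.2
    (h.isChain_assocPOPartition_of_isChain hlt (h.mem_D_iff.1 ha))

theorem mem_S5_iff : ∀ {t : ℕ} {P : POPartition n}, P ∈ S5 Gs t ↔ P ∈ S4 Gs ∧
    ∀ s ≤ t, ∀ x, P.IsChain Gs s x ↔ (assocPOPartition Gs).IsChain Gs s x
  | 0, P => ⟨fun hP => ⟨hP, fun s hs x =>
      ⟨fun h => absurd h.pos (by omega), fun h => absurd h.pos (by omega)⟩⟩, And.left⟩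
  | 1, P => by
    refine ⟨fun hP => ⟨hP, fun s hs x => ?_⟩, And.left⟩
    obtain rfl | rfl : s = 0 ∨ s = 1 := by omega
    · exact ⟨fun h => absurd h.pos (by omega), fun h => absurd h.pos (by omega)⟩
    · exact isChain_one_iff_of_mem_S4 hP x
  | t + 2, P => by
    have ih := fun {P} => mem_S5_iff (t := t + 1) (P := P)
    rw [S5, argmax_ncard_eq (ih.2 ⟨assocPOPartition_mem_S4, fun _ _ _ => Iff.rfl⟩)
      (Set.toFinite _) fun P hP => (recoversPAdj_of_mem_S4 (ih.1 hP).1).D_subset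
        fun s hs x => ((ih.1 hP).2 s (by omega) x).2]
    constructor
    · rintro ⟨hP, hD⟩
      obtain ⟨hP, hlt⟩ := ih.1 hP
      refine ⟨hP, fun s hs => ?_⟩
      rcases hs.lt_or_eq with hs | rfl
      · exact hlt s (by omega)
      · exact (recoversPAdj_of_mem_S4 hP).D_eq_iff.1 hD
    · rintro ⟨hP, hle⟩
      exact ⟨ih.2 ⟨hP, fun s hs => hle s (by omega)⟩,
        (recoversPAdj_of_mem_S4 hP).D_eq_iff.2 (hle _ le_rfl)⟩

theorem mem_S5_sub_two_iff : P ∈ S5 Gs (n - 2) ↔ P ∈ S4 Gs ∧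
    ∀ t x, P.IsChain Gs t x ↔ (assocPOPartition Gs).IsChain Gs t x := by
  rw [mem_S5_iff]
  refine and_congr_right fun _ => ⟨fun h t x => ?_, fun h t _ => h t⟩
  by_cases ht : t ≤ n - 2
  · exact h t ht x
  · have hn : ∀ {Q : POPartition n}, ¬ Q.IsChain Gs t x := fun hx => by
      have := hx.add_two_le_card
      simp only [Fintype.card_fin] at this
      omega
    exact iff_of_false hn hn

theorem mem_S6_iff : P ∈ S6 Gs ↔ P ∈ S5 Gs (n - 2) ∧ E6 Gs P = E6 Gs (assocPOPartition Gs) := by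
  rw [S6, argmin_ncard_eq
    (mem_S5_sub_two_iff.2 ⟨assocPOPartition_mem_S4, fun _ _ => Iff.rfl⟩)
    (fun P _ => E6_finite Gs P) fun P hP => by
      obtain ⟨hP, hchain⟩ := mem_S5_sub_two_iff.1 hP
      obtain ⟨hrec, -, h3⟩ := mem_S3_iff_recoversPAdj.1 (mem_S4_iff.1 hP).1
      exact hrec.E6_subset h3 fun t x => (hchain t x).2]
  rfl

end Optimality

/-! ### The four properties -/

section Properties

variable {n : ℕ} {Gs G : Digraph (Fin n)} {P : POPartition n} {a b c : Fin n}

open POPartition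

theorem hasProperties_assocPOPartition (Gs : Digraph (Fin n)) :
    HasProperties Gs (assocPOPartition Gs) Gs where
  pAdj_iff a b := (recoversPAdj_assocPOPartition Gs a b).symm
  ancestor_iff a b := by
    rw [← vle_assocPOPartition]
    rfl
  commonChild a b c h hmin := by
    obtain ⟨htriple, d, hd, hdb⟩ := mem_E3_assocPOPartition_iff.1 h
    refine ⟨d, mem_iff_sec_eq.2 ?_, hd⟩
    by_contra hne
    rw [← vle_assocPOPartition] at hdb
    exact hmin d hdb hne (mem_E3_assocPOPartition_iff.2
      ⟨hd.isUnshieldedTriple htriple.ne htriple.not_pAdj, d, hd, .refl⟩)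
  noCommonChild a b c hne hab hcb hac _ h3 := by
    rintro ⟨d, hdb, hd⟩
    have hrec := recoversPAdj_assocPOPartition Gs
    rw [hrec] at hab hcb hac
    have hle := (sec_eq_sec_iff.1 (mem_iff_sec_eq.1 hdb)).1
    rw [vle_assocPOPartition] at hle
    exact h3 (mem_E3_assocPOPartition_iff.2 ⟨⟨hne, hab, hcb, hac⟩, d, hd, hle⟩)

theorem POPartition.exists_minimal_vle {p : Fin n → Prop} (hb : p b) :
    ∃ b', P.vle b' b ∧ p b' ∧ ∀ c, p c → P.vle c b' → P.sec c = P.sec b' := by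
  obtain ⟨b', ⟨hb'b, hb'⟩, hmin⟩ := Set.exists_min_image {b' | P.vle b' b ∧ p b'}
    (fun b' => {v | P.vle v b'}.ncard) (Set.toFinite _) ⟨b, refl b, hb⟩
  refine ⟨b', hb'b, hb', fun c hc hle => sec_eq_sec_iff.2 ⟨hle, ?_⟩⟩
  have hsub : {v | P.vle v c} ⊆ {v | P.vle v b'} := fun v hv =>
    _root_.trans (r := P.vle) hv hle
  have heq := Set.eq_of_subset_of_ncard_le hsub
    (hmin c ⟨_root_.trans (r := P.vle) hle hb'b, hc⟩) (Set.toFinite _)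
  exact heq.ge (refl (r := P.vle) b')

namespace HasProperties

theorem isAncestor_eq (h : HasProperties Gs P G) : IsAncestor G = P.vle :=
  funext₂ fun a b => propext (h.ancestor_iff a b)

theorem pAdj_eq (h : HasProperties Gs P G) (hrec : RecoversPAdj Gs P) : PAdj G = PAdj Gs :=
  funext₂ fun a b => propext ((h.pAdj_iff a b).trans (hrec a b))

theorem belowCommonChild_of_mem_E3 (h : HasProperties Gs P G) (hE3 : (a, b, c) ∈ E3 Gs P) :
    BelowCommonChild G a b c := by
  obtain ⟨b', hb'b, hb', hmin⟩ := P.exists_minimal_vle (p := fun b => (a, b, c) ∈ E3 Gs P) hE3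
  obtain ⟨d, hdb', hd⟩ := h.commonChild a b' c hb' fun e he hne hE3 => hne (hmin e hE3 he)
  refine ⟨d, hd, ?_⟩
  rw [h.isAncestor_eq]
  exact _root_.trans (sec_eq_sec_iff.1 (mem_iff_sec_eq.1 hdb')).1 hb'b

theorem mem_E3_of_belowCommonChild (h : HasProperties Gs P G) (hrec : RecoversPAdj Gs P)
    (h3 : E3 Gs P = E3 Gs (assocPOPartition Gs)) (htriple : IsUnshieldedTriple Gs a b c)
    (hb : BelowCommonChild G a b c) : (a, b, c) ∈ E3 Gs P := by
  obtain ⟨d, hd, hdb⟩ := hb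
  have hac : ¬ PAdj G a c := h.pAdj_eq hrec ▸ htriple.not_pAdj
  have hadc : IsUnshieldedTriple Gs a d c :=
    (isUnshieldedTriple_congr fun a b => (h.pAdj_iff a b).trans (hrec a b)).1
      (hd.isUnshieldedTriple htriple.ne hac)
  have hE3 : (a, d, c) ∈ E3 Gs P := by
    obtain ⟨hda, hdc⟩ := (show BelowCommonChild G a d c from ⟨d, hd, .refl⟩).not_isAncestor
      htriple.ne hac
    rw [h.isAncestor_eq] at hda hdc
    by_contra hE3
    exact h.noCommonChild a d c htriple.ne ((hrec a d).2 hadc.left) ((hrec c d).2 hadc.right)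
      (mt (hrec a c).1 hadc.not_pAdj) (fun hle => hle.elim hda hdc) hE3
      ⟨d, mem_iff_sec_eq.2 rfl, hd⟩
  rw [h3, mem_E3_assocPOPartition_iff] at hE3
  rw [h.isAncestor_eq] at hdb
  exact hrec.mem_E3_of_belowCommonChild htriple hE3.2 hdb

theorem compatible (h : HasProperties Gs P G) (hP : P ∈ S6 Gs) : Compatible G Gs := by
  obtain ⟨hP, h6⟩ := mem_S6_iff.1 hP
  obtain ⟨hP, hchain⟩ := mem_S5_sub_two_iff.1 hP
  obtain ⟨hrec, -, h3⟩ := mem_S3_iff_recoversPAdj.1 (mem_S4_iff.1 hP).1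
  have hpAdj (a b) : PAdj G a b ↔ PAdj Gs a b := (h.pAdj_iff a b).trans (hrec a b)
  have hbelow {a b c} (htriple : IsUnshieldedTriple Gs a b c) :
      BelowCommonChild G a b c ↔ (a, b, c) ∈ E3 Gs P :=
    ⟨h.mem_E3_of_belowCommonChild hrec h3 htriple, h.belowCommonChild_of_mem_E3⟩
  refine ⟨hpAdj, fun a b c htriple => ?_, fun t x => ?_, fun t x b hx h0 h1 hb => ?_⟩
  · rw [isUnshieldedTriple_congr hpAdj] at htriple
    rw [hbelow htriple, h3, mem_E3_assocPOPartition_iff, and_iff_right htriple]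
  · rw [h.pAdj_eq hrec, h.isAncestor_eq, ← vle_assocPOPartition]
    exact hchain t x
  · rw [h.pAdj_eq hrec, h.isAncestor_eq] at hx
    rw [hpAdj] at h0 h1
    rw [hbelow ⟨hx.ne_ends, h0, h1, hx.not_adj_ends⟩] at hb
    have hE6 := Set.ext_iff.1 h6 ⟨t, fun i : Fin (t + 2) => x i, (x 0, b, x (t + 1))⟩
    rw [hrec.mem_E6_iff, (recoversPAdj_assocPOPartition Gs).mem_E6_iff, ← hchain t x, ← h3,
      vle_assocPOPartition] at hE6
    rw [h.isAncestor_eq]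
    tauto

end HasProperties

end Properties

end CyclicCausal

theorem mainTheorem2 (n : ℕ) (Gs : Digraph (Fin n)) :
    (∀ P ∈ CyclicCausal.S6 Gs, ∀ G : Digraph (Fin n),
      CyclicCausal.HasProperties Gs P G → CyclicCausal.MarkovEquivalent G Gs) ∧
    CyclicCausal.HasProperties Gs (CyclicCausal.assocPOPartition Gs) Gs :=
  ⟨fun _ hP _ h => (h.compatible hP).markovEquivalent,
    CyclicCausal.hasProperties_assocPOPartition Gs⟩
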